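/- For $\lambda>0$ let $G_\lambda(x)=\dfrac{e^{-\sqrt\lambda\,|x|}}{4\pi|x|}$ on $\mathbb{R}^3$, and for real $\alpha\ge 0$ let $-\Delta_\alpha$ be the non-negative self-adjoint operator on $L^2(\mathbb{R}^3)$ (the Laplacian with a point interaction at the origin) with domain $$\mathcal D(-\Delta_\alpha)=\Big\{\,f+\frac{f(0)}{\alpha+\frac{\sqrt{\lambda_0}}{4\pi}}\,G_{\lambda_0}\ \Big|\ f\in H^2(\mathbb{R}^3)\Big\}$$ and action $$(-\Delta_\alpha+\lambda_0)\Big(f+\frac{f(0)}{\alpha+\frac{\sqrt{\lambda_0}}{4\pi}}\,G_{\lambda_0}\Big)=(-\Delta+\lambda_0)f ,$$ where $\lambda_0>0$ is arbitrary (the operator does not depend on it) and $f(0)$ is the value at $0$ of the continuous representative of $f$. Let $(-\Delta_\alpha)^{s/2}$ be its fractional powers in the sense of the spectral theorem. Theorem. Let $\alpha\ge 0$, $\lambda>0$ and $s\in(0,2)$. (i) If $s\in(0,\frac12)$, then $\mathcal D((-\Delta_\alpha)^{s/2})=H^s(\mathbb{R}^3)$. (ii) If $s\in(\frac12,\frac32)$,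 then $\mathcal D((-\Delta_\alpha)^{s/2})=H^s(\mathbb{R}^3)\dotplus\mathrm{span}\{G_\lambda\}$, where $\dotplus$ denotes the (algebraic) direct sum of subspaces of $L^2(\mathbb{R}^3)$. (iii) If $s\in(\frac32,2)$, then every $F\in H^s(\mathbb{R}^3)$ has a continuous representative, whose value at $0$ is denoted by $F(0)$, and $$\mathcal D((-\Delta_\alpha)^{s/2})=\Big\{\,g\in L^2(\mathbb{R}^3)\ \Big|\ g=F+\frac{F(0)}{\alpha+\frac{\sqrt\lambda}{4\pi}}\,G_\lambda\ \text{ with } F\in H^s(\mathbb{R}^3)\Big\}.$$ -/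

import Mathlib

open MeasureTheory
open scoped SchwartzMap Laplacian ENNReal

noncomputable section

namespace PointInteraction

/-- Three-dimensional Euclidean space. -/
abbrev R3 : Type := EuclideanSpace ℝ (Fin 3)

/-- The complex Hilbert space `L²(ℝ³)`. -/
abbrev L2 : Type := Lp ℂ 2 (volume : Measure R3)

/-- The Sobolev space `H^s(ℝ³)`, as a subspace of `L²(ℝ³)` (to be used for `0 ≤ s`). -/
def sobolev (s : ℝ) : Submodule ℂ L2 where
  carrier := {f | TemperedDistribution.MemSobolev s 2 (f : 𝓢'(R3, ℂ))}
  zero_mem' := by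
    have h := TemperedDistribution.memSobolev_fun_zero R3 ℂ s 2
    rw [← map_zero (Lp.toTemperedDistributionCLM ℂ (volume : Measure R3) 2)] at h
    exact h
  add_mem' {f g} hf hg := by
    have h := TemperedDistribution.MemSobolev.add hf hg
    rw [← Lp.toTemperedDistributionCLM_apply, ← Lp.toTemperedDistributionCLM_apply,
      ← map_add] at h
    exact h
  smul_mem' c f hf := by
    have h := TemperedDistribution.MemSobolev.smul c hf
    rw [← Lp.toTemperedDistributionCLM_apply, ← map_smul] at h
    exact h

/-- The class `f` has a continuous representative, and the value of that representative at the
origin is `v`; in short, `f(0) = v`. -/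
def HasValueAtZero (f : L2) (v : ℂ) : Prop :=
  ∃ F : R3 → ℂ, Continuous F ∧ f =ᵐ[volume] F ∧ F 0 = v

/-- The function `G_l(x) = exp(-√l |x|) / (4π|x|)`. -/
def greenFun (l : ℝ) (x : R3) : ℂ :=
  ((Real.exp (-Real.sqrt l * ‖x‖) / (4 * Real.pi * ‖x‖) : ℝ) : ℂ)

theorem memLp_greenFun {l : ℝ} (hl : 0 < l) : MemLp (greenFun l) 2 (volume : Measure R3) := by
  have hm : Measurable (greenFun l) := by unfold greenFun; fun_prop
  rw [memLp_two_iff_integrable_sq_norm hm.aestronglyMeasurable]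
  have key : Integrable (fun x : R3 =>
      (fun r : ℝ => (Real.exp (-Real.sqrt l * r) / (4 * Real.pi * r)) ^ 2) ‖x‖) volume := by
    refine (integrable_fun_norm_addHaar (volume : Measure R3)
      (f := fun r : ℝ => (Real.exp (-Real.sqrt l * r) / (4 * Real.pi * r)) ^ 2)).2 ?_
    have hfin : Module.finrank ℝ R3 - 1 = 2 := by simp
    rw [hfin]
    have hi := (integrableOn_exp_mul_Ioi (a := -(2 * Real.sqrt l))
      (by have := Real.sqrt_pos.2 hl; linarith) 0).const_mul (1 / (16 * Real.pi ^ 2))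
    refine IntegrableOn.congr_fun hi ?_ measurableSet_Ioi
    intro r hr
    have hr' : r ≠ 0 := ne_of_gt hr
    have hp := Real.pi_ne_zero
    have he : Real.exp (-(2 * Real.sqrt l) * r) = Real.exp (-Real.sqrt l * r) ^ 2 := by
      rw [← Real.exp_nat_mul]; congr 1; push_cast; ring
    simp only [smul_eq_mul, he]
    field_simp
    ring
  refine key.congr (Filter.Eventually.of_forall fun x => ?_)
  simp only [greenFun, Complex.norm_real, Real.norm_eq_abs, sq_abs]

/-- `G_l` as an element of `L²(ℝ³)`. -/
def green (l : ℝ) (hl : 0 < l) : L2 := (memLp_greenFun hl).toLp (greenFun l)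

/-- The graph of `-Δ_α`: the pairs `(g, h)` with `g = f + f(0) / (α + √l/4π) G_l` for some
`f ∈ H²(ℝ³)` and `h + l g = -Δ f + l f`, the Laplacian being that of distributions. -/
def hamiltonianGraph (α l : ℝ) (hl : 0 < l) : Submodule ℂ (L2 × L2) where
  carrier := {p | ∃ f ∈ sobolev 2, ∃ v : ℂ, HasValueAtZero f v ∧
    p.1 = f + (v / ((α + Real.sqrt l / (4 * Real.pi) : ℝ) : ℂ)) • green l hl ∧
    ((p.2 + (l : ℂ) • p.1 : L2) : 𝓢'(R3, ℂ))
      = -Δ (f : 𝓢'(R3, ℂ)) + (l : ℂ) • (f : 𝓢'(R3, ℂ))}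
  zero_mem' := by
    refine ⟨0, zero_mem _, 0, ⟨0, continuous_zero, Lp.coeFn_zero _ _ _, rfl⟩, by simp, ?_⟩
    simp only [Prod.fst_zero, Prod.snd_zero, smul_zero, add_zero,
      ← Lp.toTemperedDistributionCLM_apply, map_zero,
      ← TemperedDistribution.laplacianCLM_apply, neg_zero]
  add_mem' := by
    rintro ⟨g, h⟩ ⟨g', h'⟩ ⟨f, hf, v, ⟨F, hFc, hF, hF0⟩, hg, hh⟩
      ⟨f', hf', v', ⟨F', hFc', hF', hF0'⟩, hg', hh'⟩
    refine ⟨f + f', add_mem hf hf', v + v', ⟨F + F', hFc.add hFc',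
      (Lp.coeFn_add f f').trans (hF.add hF'), by simp [hF0, hF0']⟩, ?_, ?_⟩
    · simp only at hg hg'
      simp only [Prod.mk_add_mk, hg, hg', add_div, add_smul]
      abel
    · simp only [← Lp.toTemperedDistributionCLM_apply, map_add, map_smul, Prod.mk_add_mk,
        ← TemperedDistribution.laplacianCLM_apply] at hh hh' ⊢
      calc _ = _ := by rw [smul_add, add_add_add_comm, hh, hh']
        _ = _ := by rw [smul_add]; abel
  smul_mem' := by
    rintro c ⟨g, h⟩ ⟨f, hf, v, ⟨F, hFc, hF, hF0⟩, hg, hh⟩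
    refine ⟨c • f, Submodule.smul_mem _ c hf, c * v, ⟨c • F, hFc.const_smul c,
      (Lp.coeFn_smul c f).trans (hF.const_smul c), by simp [hF0]⟩, ?_, ?_⟩
    · simp only at hg
      simp only [Prod.smul_mk, hg, smul_add, smul_smul, mul_div_assoc]
    · simp only [← Lp.toTemperedDistributionCLM_apply, map_add, map_smul, Prod.smul_mk,
        ← TemperedDistribution.laplacianCLM_apply] at hh ⊢
      rw [smul_comm (l : ℂ) c, ← smul_add, hh, smul_add, smul_neg, smul_comm (l : ℂ) c]

/-- A function in `H²(ℝ³)` is never a non-zero multiple of `G_l`, as it is continuous. -/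
theorem eq_zero_of_add_smul_green {l : ℝ} (hl : 0 < l) {f : L2} {v c : ℂ}
    (hf : HasValueAtZero f v) (h : f + c • green l hl = 0) : c = 0 := by
  by_contra hc
  obtain ⟨F, hFc, hF, -⟩ := hf
  have hae : F =ᵐ[volume] fun x => -c * greenFun l x := by
    have h1 : (f : R3 → ℂ) =ᵐ[volume] ((-c) • green l hl : L2) := by
      rw [eq_neg_of_add_eq_zero_left h, ← neg_smul]
    filter_upwards [hF, h1, Lp.coeFn_smul (-c) (green l hl),
      (memLp_greenFun hl).coeFn_toLp] with x a1 a2 a3 a4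
    rw [← a1, a2, a3, Pi.smul_apply, green, a4, smul_eq_mul]
  have heq : Set.EqOn F (fun x => -c * greenFun l x) {0}ᶜ := by
    refine Measure.eqOn_open_of_ae_eq (ae_restrict_of_ae hae) isOpen_compl_singleton
      hFc.continuousOn ?_
    have : ContinuousOn (fun x : R3 =>
        Real.exp (-Real.sqrt l * ‖x‖) / (4 * Real.pi * ‖x‖)) {0}ᶜ := by
      refine ContinuousOn.div (by fun_prop) (by fun_prop) fun x hx => ?_
      have : ‖x‖ ≠ 0 := norm_ne_zero_iff.2 hx
      have := Real.pi_ne_zero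
      positivity
    exact continuousOn_const.mul (Complex.continuous_ofReal.comp_continuousOn this)
  have hlim : Filter.Tendsto (fun x : R3 => ‖x‖ * ‖F x‖) (nhdsWithin 0 {0}ᶜ) (nhds 0) := by
    have : Continuous fun x : R3 => ‖x‖ * ‖F x‖ := by fun_prop
    simpa using (this.tendsto 0).mono_left nhdsWithin_le_nhds
  have hlim2 : Filter.Tendsto (fun x : R3 => ‖x‖ * ‖F x‖) (nhdsWithin 0 {0}ᶜ)
      (nhds (‖c‖ / (4 * Real.pi))) := by
    have h2 : Continuous fun x : R3 =>
        ‖c‖ * Real.exp (-Real.sqrt l * ‖x‖) / (4 * Real.pi) := by fun_prop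
    have h3 := (h2.tendsto 0).mono_left (nhdsWithin_le_nhds (s := ({0}ᶜ : Set R3)))
    simp only [norm_zero, mul_zero, Real.exp_zero, mul_one] at h3
    refine h3.congr' ?_
    filter_upwards [self_mem_nhdsWithin] with x hx
    have hx' : ‖x‖ ≠ 0 := norm_ne_zero_iff.2 hx
    have hp := Real.pi_pos
    rw [heq hx]
    simp only [greenFun]
    rw [norm_mul, norm_neg, Complex.norm_real, Real.norm_eq_abs,
      abs_of_nonneg (by positivity)]
    field_simp
  have : (nhdsWithin (0 : R3) {0}ᶜ).NeBot := inferInstance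
  have h0 := tendsto_nhds_unique hlim hlim2
  have hp := Real.pi_pos
  have : 0 < ‖c‖ / (4 * Real.pi) := by
    have := norm_pos_iff.2 hc
    positivity
  linarith

/-- The graph is single-valued, so that it defines an operator. -/
theorem hamiltonianGraph_single_valued (α l : ℝ) (hl : 0 < l) (p : L2 × L2)
    (hp : p ∈ hamiltonianGraph α l hl) (h0 : p.1 = 0) : p.2 = 0 := by
  obtain ⟨f, -, v, hv, hg, hh⟩ := hp
  rw [h0] at hg
  have hc := eq_zero_of_add_smul_green hl hv hg.symm
  rw [hc, zero_smul, add_zero] at hg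
  rw [h0, ← hg, smul_zero, add_zero] at hh
  simp only [← Lp.toTemperedDistributionCLM_apply, map_zero, smul_zero, add_zero,
    ← TemperedDistribution.laplacianCLM_apply, neg_zero] at hh
  have hk : p.2 ∈ (Lp.toTemperedDistributionCLM ℂ (volume : Measure R3) 2).ker := hh
  rwa [Lp.ker_toTemperedDistributionCLM_eq_bot] at hk

/-- The singular perturbation `-Δ_α` of the negative Laplacian, as an unbounded operator on
`L²(ℝ³)`. The reference value `l > 0`, with `α + √l/4π ≠ 0`, is auxiliary. -/
def hamiltonian (α l : ℝ) (hl : 0 < l) : L2 →ₗ.[ℂ] L2 :=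
  (hamiltonianGraph α l hl).toLinearPMap

theorem graph_hamiltonian (α l : ℝ) (hl : 0 < l) :
    (hamiltonian α l hl).graph = hamiltonianGraph α l hl :=
  Submodule.toLinearPMap_graph_eq _ (hamiltonianGraph_single_valued α l hl)

section SpectralCalculus

variable {H : Type*} [NormedAddCommGroup H] [InnerProductSpace ℂ H]

/-- `μ` is the (scalar) spectral measure at the vector `g` of the non-negative self-adjoint
operator `A`: the finite Borel measure on `[0, ∞)`, unique by Stieltjes inversion, such that
`⟪g, (A - z)⁻¹ g⟫ = ∫ (t - z)⁻¹ dμ(t)` for all complex `z` outside `[0, ∞)`.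
In terms of the spectral family `E` of `A` this is `μ(B) = ⟪g, E(B) g⟫`. -/
structure IsSpectralMeasure (A : H →ₗ.[ℂ] H) (g : H) (μ : Measure ℝ) : Prop where
  finite : IsFiniteMeasure μ
  nonneg : μ (Set.Iio 0) = 0
  resolvent : ∀ z : ℂ, (∀ t : ℝ, 0 ≤ t → z ≠ (t : ℂ)) →
    ∃ u : A.domain, A u - z • (u : H) = g ∧ inner ℂ g (u : H) = ∫ t : ℝ, ((t : ℂ) - z)⁻¹ ∂μ

/-- The domain of the fractional power `A ^ θ`, `θ > 0`, of a non-negative self-adjoint operator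
`A` in the sense of the spectral theorem: the vectors `g` such that `t ↦ t ^ θ` is square
integrable with respect to the spectral measure of `A` at `g`. -/
def powerDomain (A : H →ₗ.[ℂ] H) (θ : ℝ) : Set H :=
  {g | ∃ μ : Measure ℝ, IsSpectralMeasure A g μ ∧
    MemLp (fun t : ℝ => t ^ θ) 2 μ}

end SpectralCalculus

end PointInteraction

end

/-!
The proof compares the resolvents of `-Δ` and `-Δ_α` along the energies `4^n`.

For a non-negative self-adjoint operator `A` and `0 < s < 2`, a vector `g` lies in the domain of
`A^{s/2}` if and only if `∑ 4^{ns} ‖A (A + 4^n)⁻¹ g‖² < ∞`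
(`mem_powerDomain_iff_summable`): against the spectral measure of `g` the
summands become integrals of `4^{ns} (t / (t + 4^n))²`, and the sum of these functions over `n` is
comparable to `t^s` up to a bounded function. The spectral measure exists by the continuous
functional calculus of `(A + 1)⁻¹` and the Riesz–Markov theorem (`exists_isSpectralMeasure`). The
same computation on the Fourier side describes `H^s` through the free resolvent
(`mem_sobolev_iff_summable`).

The Fourier transform of `G_l` is `1 / (4π²|ξ|² + l)` (a computation by rotation to a coordinate
axis and Fubini), hence `⟪G_l, G_m⟫ = 1 / (4π (√l + √m))` and, for `f = (-Δ + l)⁻¹ w`,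
`f(0) = ⟪G_l, w⟫`. So the definition of `-Δ_α` amounts to Krein's formula
`(-Δ_α + l)⁻¹ g = (-Δ + l)⁻¹ g + ⟪G_l, g⟫ / (α + √l / 4π) • G_l` for one `l`, and then, by the
resolvent identity, for all `l`. In particular
`-Δ_α (-Δ_α + 4^n)⁻¹ g = -Δ (-Δ + 4^n)⁻¹ g - κ_n • G_{4^n}`,
where the charge `κ_n` is `4^n ⟪G_{4^n}, g⟫ / (α + 2^n / 4π)`, and `‖G_{4^n}‖` is proportional to
`2^{-n/2}`. The two domains therefore differ only through the behaviour of `κ_n`.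

* If `g` is in the domain of `(-Δ_α)^{s/2}`, the numbers
  `2^{n(s - 1/2)} (κ_{n+1} - κ_n)` are square summable (`summable_charge_sub`), since
  `(-Δ + 4^n) (-Δ + 4^{n+1})⁻¹` is a contraction. Discrete Hardy inequalities turn this into
  square summability of `2^{n(s - 1/2)} κ_n` if `s < 1/2`, so that `g ∈ H^s`, and of
  `2^{n(s - 1/2)} (κ_n - q)` for some `q` if `s > 1/2`, so that `g - q G_l ∈ H^s`.
* If `f ∈ H^s`, then `f + k G_l` is in the domain if and only if
  `2^{n(s - 3/2)} (k (α + √l / 4π) - 4^n ⟪G_{4^n}, f⟫)` is square summable. The increments of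
  `4^n ⟪G_{4^n}, f⟫` satisfy the corresponding bound, so by the Hardy inequalities again this is
  automatic if `s < 3/2`; if `s > 3/2`, the numbers `4^n ⟪G_{4^n}, f⟫` converge to `f(0)` and the
  condition says `k (α + √l / 4π) = f(0)`.
* `G_l` is not in `H^s` for `s ≥ 1/2`, whence the sum is direct.
-/

noncomputable section

namespace PointInteraction

/-! ### Discrete Hardy inequalities -/

theorem summable_sq_of_le_add {x y z : ℕ → ℝ} (C : ℝ) (hz : ∀ n, 0 ≤ z n)
    (h : ∀ n, z n ≤ C * (x n + y n))
    (hx : Summable fun n => x n ^ 2) (hy : Summable fun n => y n ^ 2) :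
    Summable fun n => z n ^ 2 := by
  refine Summable.of_nonneg_of_le (fun n => sq_nonneg _) (fun n => ?_)
    ((hx.add hy).mul_left (2 * C ^ 2))
  calc z n ^ 2 ≤ (C * (x n + y n)) ^ 2 := pow_le_pow_left₀ (hz n) (h n) 2
    _ ≤ 2 * C ^ 2 * (x n ^ 2 + y n ^ 2) := by
      nlinarith [mul_nonneg (sq_nonneg C) (sq_nonneg (x n - y n))]

theorem summable_sq_of_le {x z : ℕ → ℝ} (C : ℝ) (hz : ∀ n, 0 ≤ z n)
    (h : ∀ n, z n ≤ C * x n) (hx : Summable fun n => x n ^ 2) :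
    Summable fun n => z n ^ 2 :=
  summable_sq_of_le_add (y := fun _ => 0) C hz (by simpa using h) hx (by simp)

theorem summable_sq_geometric (C : ℝ) {ρ : ℝ} (h0 : 0 ≤ ρ) (h1 : ρ < 1) :
    Summable fun n : ℕ => (C * ρ ^ n) ^ 2 := by
  have : ∀ n : ℕ, (C * ρ ^ n) ^ 2 = C ^ 2 * (ρ ^ 2) ^ n := fun n => by ring
  simp_rw [this]
  exact (summable_geometric_of_lt_one (sq_nonneg _) (by nlinarith)).mul_left _

/-- Convexity: `(ρ x + d)² ≤ ρ x² + d² / (1 - ρ)`. -/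
theorem sq_le_of_le_mul_add {ρ x y d : ℝ} (h1 : ρ < 1) (h0 : 0 ≤ ρ)
    (hy : 0 ≤ y) (h : y ≤ ρ * x + d) : y ^ 2 ≤ ρ * x ^ 2 + d ^ 2 / (1 - ρ) := by
  have hρ : 0 < 1 - ρ := by linarith
  have h2 : y ^ 2 ≤ (ρ * x + d) ^ 2 := pow_le_pow_left₀ hy h 2
  refine h2.trans ?_
  rw [← sub_nonneg]
  have : ρ * x ^ 2 + d ^ 2 / (1 - ρ) - (ρ * x + d) ^ 2
      = ρ * ((1 - ρ) * x - d) ^ 2 / (1 - ρ) := by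
    field_simp
    ring
  rw [this]
  positivity

/-- The discrete Hardy inequality for weights that decay: the increments control the sequence. -/
theorem summable_sq_of_increments {b : ℕ → ℂ} {r : ℝ} (h0 : 0 < r) (h1 : r < 1)
    (h : Summable fun n => (r ^ n * ‖b (n + 1) - b n‖) ^ 2) :
    Summable fun n => (r ^ n * ‖b n‖) ^ 2 := by
  set D := ∑' n, (r ^ n * ‖b (n + 1) - b n‖) ^ 2
  set K := (‖b 0‖ ^ 2 + r ^ 2 * D / (1 - r)) / (1 - r)
  have hr : 0 < 1 - r := by linarith
  have step : ∀ n, (r ^ (n + 1) * ‖b (n + 1)‖) ^ 2 ≤ r * (r ^ n * ‖b n‖) ^ 2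
      + r ^ 2 * (r ^ n * ‖b (n + 1) - b n‖) ^ 2 / (1 - r) := by
    intro n
    have := sq_le_of_le_mul_add (x := r ^ n * ‖b n‖) (y := r ^ (n + 1) * ‖b (n + 1)‖)
      (d := r * (r ^ n * ‖b (n + 1) - b n‖)) h1 h0.le (by positivity) ?_
    · rwa [mul_pow r] at this
    · have hb : ‖b (n + 1)‖ ≤ ‖b n‖ + ‖b (n + 1) - b n‖ := by
        simpa using norm_add_le (b n) (b (n + 1) - b n)
      calc r ^ (n + 1) * ‖b (n + 1)‖ ≤ r ^ (n + 1) * (‖b n‖ + ‖b (n + 1) - b n‖) := by gcongr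
        _ = _ := by ring
  have hD : ∀ N, ∑ n ∈ Finset.range N, (r ^ n * ‖b (n + 1) - b n‖) ^ 2 ≤ D :=
    fun N => h.sum_le_tsum _ fun _ _ => sq_nonneg _
  have hK : K = ‖b 0‖ ^ 2 + r * K + r ^ 2 * D / (1 - r) := by
    simp only [K]; field_simp; ring
  refine summable_of_sum_range_le (c := K) (fun _ => sq_nonneg _) fun N => ?_
  induction N with
  | zero =>
    have : 0 ≤ D := tsum_nonneg fun _ => sq_nonneg _
    simp only [Finset.range_zero, Finset.sum_empty]
    positivity
  | succ N ih =>
    rw [Finset.sum_range_succ']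
    have h3 : ∑ n ∈ Finset.range N, (r ^ (n + 1) * ‖b (n + 1)‖) ^ 2
        ≤ r * K + r ^ 2 * D / (1 - r) := by
      calc _ ≤ ∑ n ∈ Finset.range N, (r * (r ^ n * ‖b n‖) ^ 2
            + r ^ 2 * (r ^ n * ‖b (n + 1) - b n‖) ^ 2 / (1 - r)) :=
            Finset.sum_le_sum fun n _ => step n
        _ = r * ∑ n ∈ Finset.range N, (r ^ n * ‖b n‖) ^ 2
            + r ^ 2 * (∑ n ∈ Finset.range N, (r ^ n * ‖b (n + 1) - b n‖) ^ 2) / (1 - r) := by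
            rw [Finset.sum_add_distrib, Finset.mul_sum, Finset.mul_sum, Finset.sum_div]
        _ ≤ _ := by
            have := hD N
            gcongr
    simp only [pow_zero, one_mul]
    linarith

/-- The discrete Hardy inequality for weights that grow: the sequence converges, and the
increments control the distance to the limit. -/
theorem exists_tendsto_summable_sq_of_increments {b : ℕ → ℂ} {r : ℝ} (h1 : 1 < r)
    (h : Summable fun n => (r ^ n * ‖b (n + 1) - b n‖) ^ 2) :
    ∃ L : ℂ, Filter.Tendsto b Filter.atTop (nhds L) ∧
      Summable fun n => (r ^ n * ‖b n - L‖) ^ 2 := by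
  have hr0 : 0 < r := by linarith
  obtain ⟨ρ, hρdef⟩ : ∃ ρ, ρ = r⁻¹ := ⟨_, rfl⟩
  have hρ0 : 0 < ρ := by rw [hρdef]; positivity
  have hρ1 : ρ < 1 := by rw [hρdef]; exact inv_lt_one_of_one_lt₀ h1
  have hρr : ρ * r = 1 := by rw [hρdef]; field_simp
  have hρ2 : 0 < 1 - ρ := by linarith
  have hsum : Summable fun n => ‖b (n + 1) - b n‖ := by
    refine Summable.of_nonneg_of_le (fun _ => norm_nonneg _) (fun n => ?_)
      ((summable_sq_geometric 1 hρ0.le hρ1).add h)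
    have : ‖b (n + 1) - b n‖ = (1 * ρ ^ n) * (r ^ n * ‖b (n + 1) - b n‖) := by
      rw [one_mul, ← mul_assoc, ← mul_pow, hρr, one_pow, one_mul]
    have h2 := sq_nonneg ((1 * ρ ^ n) - (r ^ n * ‖b (n + 1) - b n‖))
    have h3 := norm_nonneg (b (n + 1) - b n)
    nlinarith
  have hc : CauchySeq b := by
    refine cauchySeq_of_summable_dist ?_
    simpa [dist_eq_norm, norm_sub_rev] using hsum
  obtain ⟨L, hL⟩ := cauchySeq_tendsto_of_complete hc
  refine ⟨L, hL, ?_⟩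
  set D := ∑' n, (r ^ n * ‖b (n + 1) - b n‖) ^ 2
  have hD : ∀ N, ∑ n ∈ Finset.range N, (r ^ n * ‖b (n + 1) - b n‖) ^ 2 ≤ D :=
    fun N => h.sum_le_tsum _ fun _ _ => sq_nonneg _
  set K := D / (1 - ρ) / (1 - ρ)
  have key : ∀ M, ∑ n ∈ Finset.range M, (r ^ n * ‖b n - b M‖) ^ 2 ≤ K := by
    intro M
    have step : ∀ n, (r ^ n * ‖b n - b M‖) ^ 2 ≤ ρ * (r ^ (n + 1) * ‖b (n + 1) - b M‖) ^ 2
        + (r ^ n * ‖b (n + 1) - b n‖) ^ 2 / (1 - ρ) := by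
      intro n
      refine sq_le_of_le_mul_add hρ1 hρ0.le (by positivity) ?_
      have hb : ‖b n - b M‖ ≤ ‖b (n + 1) - b M‖ + ‖b (n + 1) - b n‖ := by
        have := norm_sub_le (b (n + 1) - b M) (b (n + 1) - b n)
        simpa using this
      calc r ^ n * ‖b n - b M‖ ≤ r ^ n * (‖b (n + 1) - b M‖ + ‖b (n + 1) - b n‖) := by gcongr
        _ = (ρ * r) * r ^ n * ‖b (n + 1) - b M‖ + r ^ n * ‖b (n + 1) - b n‖ := by
          rw [hρr]; ring
        _ = _ := by ring
    set S := ∑ n ∈ Finset.range M, (r ^ n * ‖b n - b M‖) ^ 2 with hS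
    have hshift : ∑ n ∈ Finset.range M, (r ^ (n + 1) * ‖b (n + 1) - b M‖) ^ 2 ≤ S := by
      have h2 := Finset.sum_range_succ' (fun n => (r ^ n * ‖b n - b M‖) ^ 2) M
      rw [Finset.sum_range_succ] at h2
      simp only [sub_self, norm_zero, mul_zero, ne_eq, OfNat.ofNat_ne_zero, not_false_eq_true,
        zero_pow, add_zero] at h2
      rw [hS, h2]
      have : 0 ≤ (r ^ 0 * ‖b 0 - b M‖) ^ 2 := sq_nonneg _
      linarith
    have hSle : S ≤ ρ * S + D / (1 - ρ) := by
      calc S ≤ ∑ n ∈ Finset.range M, (ρ * (r ^ (n + 1) * ‖b (n + 1) - b M‖) ^ 2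
            + (r ^ n * ‖b (n + 1) - b n‖) ^ 2 / (1 - ρ)) := Finset.sum_le_sum fun n _ => step n
        _ = ρ * ∑ n ∈ Finset.range M, (r ^ (n + 1) * ‖b (n + 1) - b M‖) ^ 2
            + (∑ n ∈ Finset.range M, (r ^ n * ‖b (n + 1) - b n‖) ^ 2) / (1 - ρ) := by
            rw [Finset.sum_add_distrib, Finset.mul_sum, Finset.sum_div]
        _ ≤ _ := by
            have := hD M
            gcongr
    rw [le_div_iff₀ hρ2]
    linarith
  refine summable_of_sum_range_le (c := K) (fun _ => sq_nonneg _) fun N => ?_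
  have hlim : Filter.Tendsto (fun M => ∑ n ∈ Finset.range N, (r ^ n * ‖b n - b M‖) ^ 2)
      Filter.atTop (nhds (∑ n ∈ Finset.range N, (r ^ n * ‖b n - L‖) ^ 2)) := by
    refine tendsto_finsetSum _ fun n _ => ?_
    exact (((tendsto_const_nhds.sub hL).norm).const_mul _).pow 2
  refine le_of_tendsto hlim ?_
  filter_upwards [Filter.eventually_ge_atTop N] with M hM
  refine le_trans ?_ (key M)
  exact Finset.sum_le_sum_of_subset_of_nonneg (Finset.range_mono hM) fun _ _ _ => sq_nonneg _

/-! ### Dyadic characterization of fractional moments -/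

/-- The weight `∑_{n < N} 4^{ns} (t / (t + 4^n))²` is at most a multiple of `1 + t^s`.  Replacing
`t` by `t / 4` shifts the sum by one place, which allows an induction on the size of `t`. -/
theorem exists_sum_le_rpow {s : ℝ} (hs0 : 0 < s) (hs2 : s < 2) :
    ∃ C : ℝ, 0 ≤ C ∧ ∀ (t : ℝ), 0 ≤ t → ∀ N : ℕ,
      ∑ n ∈ Finset.range N, ((2 ^ s : ℝ) ^ n * (t / (t + 4 ^ n))) ^ 2 ≤ C * (1 + t ^ s) := by
  set q : ℝ := (2 : ℝ) ^ s with hq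
  have hq1 : 1 < q := Real.one_lt_rpow (by norm_num) hs0
  have hq4 : q < 4 := by
    calc q < (2 : ℝ) ^ (2 : ℝ) := Real.rpow_lt_rpow_of_exponent_lt (by norm_num) hs2
      _ = 4 := by norm_num
  have hq2 : q ^ 2 = 4 ^ s := by
    rw [hq, ← Real.rpow_mul_natCast (by norm_num), mul_comm, Real.rpow_mul (by norm_num)]
    norm_num
  have hgeo := summable_sq_geometric 1 (ρ := q / 4) (by positivity) (by linarith)
  set K₀ := ∑' n : ℕ, (1 * (q / 4) ^ n) ^ 2
  have hK₀ : 0 ≤ K₀ := tsum_nonneg fun _ => sq_nonneg _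
  set c := (q ^ 2 - 1)⁻¹
  have hqq : 0 < q ^ 2 - 1 := by nlinarith
  have hc : 0 < c := inv_pos.2 hqq
  have hcq : c * q ^ 2 = 1 + c := by simp only [c]; field_simp; ring
  have main : ∀ m : ℕ, ∀ t : ℝ, 0 ≤ t → t ≤ 4 ^ m → ∀ N : ℕ,
      ∑ n ∈ Finset.range N, (q ^ n * (t / (t + 4 ^ n))) ^ 2 ≤ (K₀ + c) * (q ^ 2) ^ m - c := by
    intro m
    induction m with
    | zero =>
      intro t ht ht1 N
      rw [pow_zero] at ht1
      calc _ ≤ ∑ n ∈ Finset.range N, (1 * (q / 4) ^ n) ^ 2 := by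
            refine Finset.sum_le_sum fun n _ => pow_le_pow_left₀ (by positivity) ?_ 2
            rw [one_mul, div_pow, div_eq_mul_inv (q ^ n)]
            gcongr
            rw [div_le_iff₀ (by positivity), inv_mul_eq_div, le_div_iff₀ (by positivity)]
            nlinarith [pow_pos (show (0 : ℝ) < 4 by norm_num) n]
        _ ≤ K₀ := hgeo.sum_le_tsum _ fun _ _ => sq_nonneg _
        _ = _ := by ring
    | succ m ih =>
      intro t ht htm N
      cases N with
      | zero =>
        simp only [Finset.range_zero, Finset.sum_empty, sub_nonneg]
        have : 1 ≤ (q ^ 2) ^ (m + 1) := one_le_pow₀ (by nlinarith)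
        nlinarith
      | succ N =>
        rw [Finset.sum_range_succ']
        have h4 : t / 4 ≤ 4 ^ m := by rw [pow_succ] at htm; linarith
        have h5 := ih (t / 4) (by linarith) h4 N
        have h6 : ∀ n, (q ^ (n + 1) * (t / (t + 4 ^ (n + 1)))) ^ 2
            = q ^ 2 * (q ^ n * (t / 4 / (t / 4 + 4 ^ n))) ^ 2 := by
          intro n
          have : t / 4 / (t / 4 + 4 ^ n) = t / (t + 4 ^ (n + 1)) := by
            have : t + 4 ^ (n + 1) ≠ 0 := by positivity
            rw [pow_succ] at this ⊢
            field_simp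
          rw [this]; ring
        simp only [h6, ← Finset.mul_sum]
        have h7 : (q ^ 0 * (t / (t + 4 ^ 0))) ^ 2 ≤ 1 := by
          rw [pow_zero, pow_zero, one_mul]
          refine pow_le_one₀ (by positivity) ?_
          rw [div_le_one (by positivity)]; linarith
        calc _ ≤ q ^ 2 * ((K₀ + c) * (q ^ 2) ^ m - c) + 1 := by gcongr
          _ = _ := by rw [pow_succ (q ^ 2)]; linear_combination -hcq
  refine ⟨(K₀ + c) * 4 ^ s, by positivity, fun t ht N => ?_⟩
  by_cases ht1 : t ≤ 1
  · refine (main 0 t ht (by simpa using ht1) N).trans ?_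
    rw [pow_zero, mul_one]
    have h1 : (1 : ℝ) ≤ 4 ^ s := Real.one_le_rpow (by norm_num) hs0.le
    have h2 : 0 ≤ t ^ s := Real.rpow_nonneg ht s
    calc K₀ + c - c ≤ (K₀ + c) * 1 * 1 := by linarith
      _ ≤ _ := by gcongr; linarith
  · push Not at ht1
    obtain ⟨m, hm1, hm2⟩ := exists_nat_pow_near ht1.le (show (1 : ℝ) < 4 by norm_num)
    refine (main (m + 1) t ht hm2.le N).trans ?_
    have h3 : (q ^ 2) ^ m ≤ t ^ s := by
      rw [hq2, ← Real.rpow_natCast, ← Real.rpow_mul (by norm_num), mul_comm,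
        Real.rpow_mul (by norm_num), Real.rpow_natCast]
      exact Real.rpow_le_rpow (by positivity) hm1 hs0.le
    calc _ ≤ (K₀ + c) * (q ^ 2) ^ (m + 1) := by linarith
      _ = (K₀ + c) * q ^ 2 * (q ^ 2) ^ m := by ring
      _ ≤ (K₀ + c) * 4 ^ s * (1 + t ^ s) := by
        rw [hq2] at h3 ⊢
        gcongr
        linarith

/-- The term with `4^n ≤ t < 4^{n+1}` bounds `t^s`. -/
theorem exists_rpow_le_term {s : ℝ} (hs0 : 0 < s) {t : ℝ} (ht : 1 ≤ t) :
    ∃ n : ℕ, t ^ s ≤ 4 * 4 ^ s * ((2 ^ s : ℝ) ^ n * (t / (t + 4 ^ n))) ^ 2 := by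
  obtain ⟨n, hn1, hn2⟩ := exists_nat_pow_near ht (show (1 : ℝ) < 4 by norm_num)
  refine ⟨n, ?_⟩
  have hq2 : ((2 : ℝ) ^ s) ^ 2 = 4 ^ s := by
    rw [← Real.rpow_mul_natCast (by norm_num), mul_comm, Real.rpow_mul (by norm_num)]
    norm_num
  have h1 : t ^ s ≤ (4 ^ s) ^ (n + 1) := by
    rw [← Real.rpow_natCast ((4 : ℝ) ^ s), ← Real.rpow_mul (by norm_num), mul_comm s,
      Real.rpow_mul (by norm_num), Real.rpow_natCast]
    exact Real.rpow_le_rpow (by linarith) hn2.le hs0.le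
  have h2 : (1 : ℝ) / 2 ≤ t / (t + 4 ^ n) := by
    rw [div_le_div_iff₀ (by norm_num) (by positivity)]; linarith
  calc t ^ s ≤ (4 ^ s) ^ (n + 1) := h1
    _ = 4 * 4 ^ s * (((2 : ℝ) ^ s) ^ n * (1 / 2)) ^ 2 := by
      rw [← hq2]; ring
    _ ≤ _ := by gcongr

/-- For `0 < s < 2`, the moment `∫ T^s dν` of a finite measure `ν` is finite if and only if the
series `∑ 4^{ns} ∫ (T / (T + 4^n))² dν` converges. -/
theorem integrable_rpow_iff_summable {Ω : Type*} [MeasurableSpace Ω] {ν : Measure Ω}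
    [IsFiniteMeasure ν] {T : Ω → ℝ} (hTm : Measurable T) (hT : ∀ᵐ x ∂ν, 0 ≤ T x) {s : ℝ}
    (hs0 : 0 < s) (hs2 : s < 2) {a : ℕ → ℝ}
    (haT : ∀ n, a n ^ 2 = ∫ x, (T x / (T x + 4 ^ n)) ^ 2 ∂ν) :
    Integrable (fun x => T x ^ s) ν ↔ Summable fun n => ((2 ^ s : ℝ) ^ n * a n) ^ 2 := by
  set q : ℝ := (2 : ℝ) ^ s with hq
  have hq0 : 0 < q := by positivity
  have hmeas : ∀ n : ℕ, Measurable fun x => (q ^ n * (T x / (T x + 4 ^ n))) ^ 2 := by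
    intro n; fun_prop
  have hint : ∀ n : ℕ, Integrable (fun x => (q ^ n * (T x / (T x + 4 ^ n))) ^ 2) ν := by
    intro n
    refine Integrable.of_bound (hmeas n).aestronglyMeasurable ((q ^ n) ^ 2) ?_
    filter_upwards [hT] with x hx
    rw [Real.norm_of_nonneg (sq_nonneg _), mul_pow]
    have : (T x / (T x + 4 ^ n)) ^ 2 ≤ 1 := by
      refine pow_le_one₀ (by positivity) ?_
      rw [div_le_one (by positivity)]
      have : (0 : ℝ) < 4 ^ n := by positivity
      linarith
    nlinarith [sq_nonneg (q ^ n)]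
  have hterm : ∀ n, (q ^ n * a n) ^ 2 = ∫ x, (q ^ n * (T x / (T x + 4 ^ n))) ^ 2 ∂ν := by
    intro n
    simp_rw [mul_pow, integral_const_mul, haT]
  constructor
  · intro hI
    obtain ⟨C, -, hC⟩ := exists_sum_le_rpow hs0 hs2
    refine summable_of_sum_range_le (c := ∫ x, C * (1 + T x ^ s) ∂ν) (fun _ => sq_nonneg _)
      fun N => ?_
    simp_rw [hterm]
    rw [← integral_finsetSum _ fun n _ => hint n]
    refine integral_mono_ae (integrable_finsetSum _ fun n _ => hint n)
      (((integrable_const _).add hI).const_mul C) ?_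
    filter_upwards [hT] with x hx
    exact hC _ hx N
  · intro hS
    have hfin : ∫⁻ x, ∑' n : ℕ, ENNReal.ofReal ((q ^ n * (T x / (T x + 4 ^ n))) ^ 2) ∂ν < ∞ := by
      rw [lintegral_tsum fun n => (hmeas n).ennreal_ofReal.aemeasurable]
      have : ∀ n : ℕ, ∫⁻ x, ENNReal.ofReal ((q ^ n * (T x / (T x + 4 ^ n))) ^ 2) ∂ν
          = ENNReal.ofReal ((q ^ n * a n) ^ 2) := by
        intro n
        rw [hterm, ofReal_integral_eq_lintegral_ofReal (hint n)
          (Filter.Eventually.of_forall fun _ => sq_nonneg _)]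
      simp_rw [this]
      rw [← ENNReal.ofReal_tsum_of_nonneg (fun _ => sq_nonneg _) hS]
      exact ENNReal.ofReal_lt_top
    refine ⟨(hTm.pow_const s).aestronglyMeasurable, ?_⟩
    rw [hasFiniteIntegral_iff_norm]
    calc ∫⁻ x, ENNReal.ofReal ‖T x ^ s‖ ∂ν
        ≤ ∫⁻ x, (1 + ENNReal.ofReal (4 * 4 ^ s) *
          ∑' n : ℕ, ENNReal.ofReal ((q ^ n * (T x / (T x + 4 ^ n))) ^ 2)) ∂ν := by
          refine lintegral_mono_ae ?_
          filter_upwards [hT] with x hx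
          rw [Real.norm_of_nonneg (Real.rpow_nonneg hx s)]
          by_cases h1 : T x ≤ 1
          · refine le_trans ?_ le_self_add
            rw [← ENNReal.ofReal_one]
            exact ENNReal.ofReal_le_ofReal (Real.rpow_le_one hx h1 hs0.le)
          · push Not at h1
            obtain ⟨n, hn⟩ := exists_rpow_le_term hs0 h1.le
            refine le_trans ?_ le_add_self
            refine (ENNReal.ofReal_le_ofReal hn).trans ?_
            rw [ENNReal.ofReal_mul (by positivity)]
            gcongr
            exact ENNReal.le_tsum n
      _ < ∞ := by
          rw [lintegral_add_left measurable_const, lintegral_const_mul _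
            (Measurable.tsum fun n => (hmeas n).ennreal_ofReal)]
          refine ENNReal.add_lt_top.2 ⟨?_, ENNReal.mul_lt_top ENNReal.ofReal_lt_top hfin⟩
          simp

section AbstractSpectral

variable {H : Type*} [NormedAddCommGroup H] [InnerProductSpace ℂ H]

/-! ### Spectral measures of non-negative self-adjoint operators -/

/-- A non-negative self-adjoint operator, described as a symmetric non-negative operator `A` such
that `A + 1` is onto. -/
structure IsNonnegSelfAdjoint (A : H →ₗ.[ℂ] H) : Prop where
  symm : ∀ u v : A.domain, inner ℂ (A u) (v : H) = inner ℂ (u : H) (A v)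
  nonneg : ∀ u : A.domain, 0 ≤ (inner ℂ (u : H) (A u)).re
  surj : ∀ g : H, ∃ u : A.domain, A u + (u : H) = g

namespace IsNonnegSelfAdjoint

variable {A : H →ₗ.[ℂ] H}

theorem norm_add_smul_sq (u : A.domain) (l : ℝ) :
    ‖A u + (l : ℂ) • (u : H)‖ ^ 2
      = ‖A u‖ ^ 2 + 2 * l * (inner ℂ (u : H) (A u)).re + l ^ 2 * ‖(u : H)‖ ^ 2 := by
  rw [norm_add_sq (𝕜 := ℂ), inner_smul_right, norm_smul, ← inner_conj_symm (A u) (u : H)]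
  simp only [RCLike.re_to_complex, Complex.mul_re, Complex.ofReal_re, Complex.ofReal_im,
    Complex.conj_re, zero_mul, sub_zero, Complex.norm_real, mul_pow, Real.norm_eq_abs, sq_abs]
  ring

theorem mul_norm_le (hA : IsNonnegSelfAdjoint A) (u : A.domain) {l : ℝ} (hl : 0 ≤ l) :
    l * ‖(u : H)‖ ≤ ‖A u + (l : ℂ) • (u : H)‖ := by
  refine le_of_sq_le_sq ?_ (norm_nonneg _)
  rw [norm_add_smul_sq]
  have := mul_nonneg hl (hA.nonneg u)
  nlinarith [sq_nonneg ‖A u‖]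

theorem eq_of_add_smul_eq (hA : IsNonnegSelfAdjoint A) {u v : A.domain} {l : ℝ} (hl : 0 < l)
    (h : A u + (l : ℂ) • (u : H) = A v + (l : ℂ) • (v : H)) : u = v := by
  have h1 := hA.mul_norm_le (u - v) hl.le
  have h2 : A (u - v) + (l : ℂ) • ((u - v : A.domain) : H) = 0 := by
    rw [LinearPMap.map_sub, Submodule.coe_sub, smul_sub, sub_add_sub_comm, h, sub_self]
  rw [h2, norm_zero] at h1
  have h3 : ‖((u - v : A.domain) : H)‖ = 0 := by
    have := norm_nonneg ((u - v : A.domain) : H)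
    nlinarith
  have h4 := norm_eq_zero.1 h3
  rw [Submodule.coe_sub, sub_eq_zero] at h4
  exact Subtype.ext h4

/-- The resolvent `(A + 1)⁻¹`. -/
theorem exists_resolvent (hA : IsNonnegSelfAdjoint A) :
    ∃ R : H →L[ℂ] H, ‖R‖ ≤ 1 ∧ ∀ w, ∃ u : A.domain, (u : H) = R w ∧ A u = w - R w := by
  choose S hS using hA.surj
  have hS' : ∀ w, A (S w) + ((1 : ℝ) : ℂ) • (S w : H) = w := fun w => by simp [hS]
  have huniq : ∀ (v : A.domain) (w : H), A v + (v : H) = w → S w = v := fun v w h =>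
    hA.eq_of_add_smul_eq one_pos (by rw [hS']; simp [h])
  let R₀ : H →ₗ[ℂ] H :=
    { toFun := fun w => (S w : H)
      map_add' := fun w w' => by
        rw [huniq (S w + S w') (w + w'), Submodule.coe_add]
        rw [LinearPMap.map_add, Submodule.coe_add, add_add_add_comm, hS, hS]
      map_smul' := fun c w => by
        rw [huniq (c • S w) (c • w), Submodule.coe_smul, RingHom.id_apply]
        rw [LinearPMap.map_smul, Submodule.coe_smul, ← smul_add, hS] }
  have hb : ∀ w, ‖R₀ w‖ ≤ 1 * ‖w‖ := fun w => by
    have := hA.mul_norm_le (S w) zero_le_one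
    rw [hS', one_mul] at this
    simpa [R₀] using this
  refine ⟨R₀.mkContinuous 1 hb, R₀.mkContinuous_norm_le zero_le_one hb, fun w => ⟨S w, rfl, ?_⟩⟩
  exact eq_sub_of_add_eq (hS w)

variable [CompleteSpace H]

theorem dense_domain (hA : IsNonnegSelfAdjoint A) : Dense (A.domain : Set H) := by
  rw [Submodule.dense_iff_topologicalClosure_eq_top, Submodule.topologicalClosure_eq_top_iff,
    Submodule.eq_bot_iff]
  intro h hh
  obtain ⟨u, hu⟩ := hA.surj h
  have h1 : inner ℂ (u : H) h = 0 := (Submodule.mem_orthogonal _ _).1 hh _ u.2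
  rw [← hu, inner_add_right, inner_self_eq_norm_sq_to_K] at h1
  have h2 := congrArg Complex.re h1
  have h3 := hA.nonneg u
  have h4 : ‖(u : H)‖ ^ 2 = 0 := by
    have : (((‖(u : H)‖ : ℂ)) ^ 2).re = ‖(u : H)‖ ^ 2 := by norm_cast
    simp only [Complex.add_re, Complex.zero_re, Complex.coe_algebraMap] at h2
    nlinarith [sq_nonneg ‖(u : H)‖]
  have h5 : u = 0 := by
    have : (u : H) = 0 := by simpa using h4
    exact Subtype.ext this
  rw [← hu, h5]
  simp

open scoped CompactlySupported in
/-- The spectral theorem, in the form of the existence of scalar spectral measures: the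
Riesz–Markov theorem applied to the continuous functional calculus of `R = (A + 1)⁻¹` gives a
measure on the spectrum of `R`, which is transported by `r ↦ 1 / r - 1`. A possible mass at
`r = 0` is dropped, which does not affect the resolvents. -/
theorem exists_isSpectralMeasure (hA : IsNonnegSelfAdjoint A) (g : H) :
    ∃ μ : Measure ℝ, IsSpectralMeasure A g μ := by
  obtain ⟨R, hR1, hR⟩ := hA.exists_resolvent
  have hpos : R.IsPositive := by
    constructor
    · intro w w'
      obtain ⟨u, hu, hu'⟩ := hR w
      obtain ⟨v, hv, hv'⟩ := hR w'
      have h1 := hA.symm u v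
      rw [hu, hv, hu', hv', inner_sub_left, inner_sub_right] at h1
      simp only [ContinuousLinearMap.coe_coe]
      linear_combination -h1
    · intro w
      obtain ⟨u, hu, hu'⟩ := hR w
      have h1 := hA.nonneg u
      rw [hu, hu', inner_sub_right, inner_self_eq_norm_sq_to_K] at h1
      rw [ContinuousLinearMap.reApplyInnerSelf_apply]
      have : (((‖R w‖ : ℂ)) ^ 2).re = ‖R w‖ ^ 2 := by norm_cast
      simp only [Complex.sub_re, Complex.coe_algebraMap] at h1
      have := sq_nonneg ‖R w‖
      simp only [RCLike.re_to_complex]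
      linarith
  have hR0 : 0 ≤ R := (ContinuousLinearMap.nonneg_iff_isPositive R).2 hpos
  have hsa : IsSelfAdjoint R := IsSelfAdjoint.of_nonneg hR0
  have hsp0 : ∀ r ∈ spectrum ℝ R, 0 ≤ r := spectrum_nonneg_of_nonneg hR0
  have hsp1 : ∀ r ∈ spectrum ℝ R, r ≤ 1 := by
    intro r hr
    have h1 := spectrum.norm_le_norm_mul_of_mem hr
    have h2 : ‖(1 : H →L[ℂ] H)‖ ≤ 1 := ContinuousLinearMap.norm_id_le
    calc r ≤ ‖r‖ := Real.le_norm_self r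
      _ ≤ ‖R‖ * ‖(1 : H →L[ℂ] H)‖ := h1
      _ ≤ 1 * 1 := by gcongr
      _ = 1 := one_mul 1
  let X := spectrum ℝ R
  let Φ : C(X, ℝ) →⋆ₐ[ℝ] (H →L[ℂ] H) := cfcHom hsa
  have hΦid : Φ ((ContinuousMap.id ℝ).restrict X) = R := cfcHom_id hsa
  have hΦreal : ∀ f : C(X, ℝ), inner ℂ g (Φ f g) = ((inner ℂ g (Φ f g)).re : ℂ) := by
    intro f
    have h1 : IsSelfAdjoint (Φ f) := cfcHom_predicate hsa f
    have h2 := (ContinuousLinearMap.isSelfAdjoint_iff_isSymmetric.1 h1) g g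
    simp only [ContinuousLinearMap.coe_coe] at h2
    rw [← inner_conj_symm] at h2
    exact (Complex.conj_eq_iff_real.1 h2).elim fun r hr => by rw [hr]; simp
  let Λ : C_c(X, ℝ) →ₚ[ℝ] ℝ := PositiveLinearMap.mk₀
    { toFun := fun f => (inner ℂ g (Φ (f : C(X, ℝ)) g)).re
      map_add' := fun f f' => by
        have : ((f + f' : C_c(X, ℝ)) : C(X, ℝ)) = (f : C(X, ℝ)) + (f' : C(X, ℝ)) := rfl
        rw [this, map_add, _root_.add_apply, inner_add_right, Complex.add_re]
      map_smul' := fun c f => by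
        have : ((c • f : C_c(X, ℝ)) : C(X, ℝ)) = c • (f : C(X, ℝ)) := rfl
        rw [this, map_smul, _root_.smul_apply, inner_smul_right_eq_smul]
        simp }
    (fun f hf => by
      have h1 : (0 : C(X, ℝ)) ≤ (f : C(X, ℝ)) := fun x => hf x
      have h2 : 0 ≤ Φ (f : C(X, ℝ)) := (cfcHom_nonneg_iff hsa).2 h1
      have h3 := ((ContinuousLinearMap.nonneg_iff_isPositive _).1 h2).re_inner_nonneg_right g
      simpa using h3)
  let ν : Measure X := RealRMK.rieszMeasure Λ
  have hν : ∀ f : C(X, ℝ), ∫ x, f x ∂ν = (inner ℂ g (Φ f g)).re := fun f =>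
    RealRMK.integral_rieszMeasure Λ ⟨f, HasCompactSupport.of_compactSpace _⟩
  let U : Set X := {x | (0 : ℝ) < x}
  have hU : MeasurableSet U := measurableSet_lt measurable_const measurable_subtype_coe
  let τ : X → ℝ := fun x => (x : ℝ)⁻¹ - 1
  have hτ : Measurable τ := by fun_prop
  refine ⟨(ν.restrict U).map τ, ⟨inferInstance, ?_, ?_⟩⟩
  · rw [Measure.map_apply hτ measurableSet_Iio, Measure.restrict_apply (hτ measurableSet_Iio)]
    convert measure_empty (μ := ν)
    ext x
    simp only [Set.mem_inter_iff, Set.mem_preimage, Set.mem_Iio, Set.mem_empty_iff_false,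
      iff_false, not_and, τ, U]
    intro h1 (h2 : (0 : ℝ) < x)
    have := one_le_inv₀ h2 |>.2 (hsp1 x x.2)
    linarith
  · intro z hz
    have hD : ∀ x : X, (1 : ℂ) - (1 + z) * ((x : ℝ) : ℂ) ≠ 0 := by
      intro x h
      have hx0 : (x : ℝ) ≠ 0 := by
        intro h0
        rw [h0] at h
        simp at h
      have hxpos : (0 : ℝ) < x := lt_of_le_of_ne (hsp0 x x.2) hx0.symm
      have hxc : ((x : ℝ) : ℂ) ≠ 0 := by exact_mod_cast hx0
      refine hz ((x : ℝ)⁻¹ - 1) ?_ ?_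
      · have := one_le_inv₀ hxpos |>.2 (hsp1 x x.2)
        linarith
      · push_cast
        field_simp
        linear_combination -h
    let F : X → ℂ := fun x => ((x : ℝ) : ℂ) / (1 - (1 + z) * ((x : ℝ) : ℂ))
    have hF : Continuous F := by
      refine Continuous.div (by fun_prop) (by fun_prop) hD
    have hFeq : ∀ x : X, F x * (1 - (1 + z) * ((x : ℝ) : ℂ)) = ((x : ℝ) : ℂ) := fun x =>
      div_mul_cancel₀ _ (hD x)
    let a : C(X, ℝ) := ⟨fun x => (F x).re, Complex.continuous_re.comp hF⟩
    let b : C(X, ℝ) := ⟨fun x => (F x).im, Complex.continuous_im.comp hF⟩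
    let i : C(X, ℝ) := (ContinuousMap.id ℝ).restrict X
    have ha : a = i + (1 + z.re) • (i * a) - z.im • (i * b) := by
      ext x
      have := congrArg Complex.re (hFeq x)
      simp only [Complex.mul_re, Complex.sub_re, Complex.one_re, Complex.add_re, Complex.ofReal_re,
        Complex.ofReal_im, Complex.sub_im, Complex.one_im, Complex.mul_im, Complex.add_im] at this
      simp only [a, b, i, ContinuousMap.coe_mk, ContinuousMap.add_apply, ContinuousMap.sub_apply,
        ContinuousMap.smul_apply, ContinuousMap.mul_apply, ContinuousMap.restrict_apply,
        ContinuousMap.id_apply, smul_eq_mul]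
      linear_combination this
    have hb : b = (1 + z.re) • (i * b) + z.im • (i * a) := by
      ext x
      have := congrArg Complex.im (hFeq x)
      simp only [Complex.mul_re, Complex.sub_re, Complex.one_re, Complex.add_re, Complex.ofReal_re,
        Complex.ofReal_im, Complex.sub_im, Complex.one_im, Complex.mul_im, Complex.add_im] at this
      simp only [a, b, i, ContinuousMap.coe_mk, ContinuousMap.add_apply,
        ContinuousMap.smul_apply, ContinuousMap.mul_apply, ContinuousMap.restrict_apply,
        ContinuousMap.id_apply, smul_eq_mul]
      linear_combination this
    have hXa : Φ a g = R g + ((1 + z.re : ℝ) : ℂ) • R (Φ a g) - ((z.im : ℝ) : ℂ) • R (Φ b g) := by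
      conv_lhs => rw [ha]
      simp only [map_add, map_sub, map_smul, map_mul, _root_.add_apply, i, hΦid,
        _root_.sub_apply, _root_.smul_apply, Complex.coe_smul]
      rfl
    have hXb : Φ b g = ((1 + z.re : ℝ) : ℂ) • R (Φ b g) + ((z.im : ℝ) : ℂ) • R (Φ a g) := by
      conv_lhs => rw [hb]
      simp only [map_add, map_smul, map_mul, _root_.add_apply, i, hΦid,
        _root_.smul_apply, Complex.coe_smul]
      rfl
    have hz' : z = (z.re : ℂ) + (z.im : ℂ) * Complex.I := (Complex.re_add_im z).symm
    let w : H := Φ a g + Complex.I • Φ b g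
    have hw : w = R (g + (1 + z) • w) := by
      have h1 : R (g + (1 + z) • w) = (R g + ((1 + z.re : ℝ) : ℂ) • R (Φ a g)
          - ((z.im : ℝ) : ℂ) • R (Φ b g))
          + Complex.I • (((1 + z.re : ℝ) : ℂ) • R (Φ b g) + ((z.im : ℝ) : ℂ) • R (Φ a g)) := by
        simp only [w, map_add, map_smul]
        match_scalars
        · ring
        · conv_lhs => rw [hz']
          ring
        · conv_lhs => rw [hz']
          linear_combination (z.im : ℂ) * Complex.I_mul_I
      rw [h1, ← hXa, ← hXb]
    obtain ⟨u, hu, hu'⟩ := hR (g + (1 + z) • w)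
    rw [← hw] at hu hu'
    refine ⟨u, ?_, ?_⟩
    · rw [hu, hu']
      module
    · have hint : Integrable F ν :=
        (BoundedContinuousFunction.mkOfCompact ⟨F, hF⟩).integrable ν
      have hres : ∫ t : ℝ, ((t : ℂ) - z)⁻¹ ∂(ν.restrict U).map τ = ∫ x, F x ∂ν := by
        rw [integral_map hτ.aemeasurable (by
          refine Measurable.aestronglyMeasurable ?_; fun_prop)]
        rw [← integral_indicator hU]
        congr 1
        ext x
        by_cases hx : x ∈ U
        · rw [Set.indicator_of_mem hx]
          have hx0 : ((x : ℝ) : ℂ) ≠ 0 := by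
            have : (0 : ℝ) < x := hx
            exact_mod_cast this.ne'
          simp only [τ, F]
          rw [inv_eq_one_div, div_eq_div_iff _ (hD x)]
          · push_cast
            field_simp
            ring
          · have := hD x
            intro h
            apply this
            push_cast at h
            field_simp at h
            linear_combination h
        · rw [Set.indicator_of_notMem hx]
          have : (x : ℝ) = 0 := le_antisymm (not_lt.1 hx) (hsp0 x x.2)
          simp [F, this]
      rw [hres, hu, inner_add_right, inner_smul_right, hΦreal a, hΦreal b, ← hν, ← hν,
        ← integral_re_add_im hint]
      simp only [a, b, ContinuousMap.coe_mk, RCLike.re_to_complex, RCLike.im_to_complex,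
        RCLike.I_to_complex, Complex.coe_algebraMap]
      ring

end IsNonnegSelfAdjoint

variable {A : H →ₗ.[ℂ] H} {g : H} {μ : Measure ℝ}

/-! ### Moments of spectral measures through resolvents -/

namespace IsSpectralMeasure

theorem ae_nonneg (h : IsSpectralMeasure A g μ) : ∀ᵐ t ∂μ, 0 ≤ t := by
  have := measure_eq_zero_iff_ae_notMem.1 h.nonneg
  filter_upwards [this] with t ht using not_lt.1 ht

theorem exists_resolvent (h : IsSpectralMeasure A g μ) {l : ℝ} (hl : 0 < l) :
    ∃ u : A.domain, A u + (l : ℂ) • (u : H) = g ∧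
      inner ℂ g (u : H) = ((∫ t, (t + l)⁻¹ ∂μ : ℝ) : ℂ) := by
  obtain ⟨u, hu, hu'⟩ := h.resolvent (-(l : ℂ)) (by
    intro t ht heq
    have : -l = t := by exact_mod_cast heq
    linarith)
  refine ⟨u, by rw [← hu, neg_smul, sub_neg_eq_add], ?_⟩
  rw [hu', show ((∫ t, (t + l)⁻¹ ∂μ : ℝ) : ℂ) = ∫ t, (((t + l)⁻¹ : ℝ) : ℂ) ∂μ from
    integral_ofReal.symm]
  simp

theorem inner_resolvent (h : IsSpectralMeasure A g μ) (hA : IsNonnegSelfAdjoint A) {l : ℝ}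
    (hl : 0 < l) {u : A.domain} (hu : A u + (l : ℂ) • (u : H) = g) :
    inner ℂ g (u : H) = ((∫ t, (t + l)⁻¹ ∂μ : ℝ) : ℂ) := by
  obtain ⟨v, hv, hv'⟩ := h.exists_resolvent hl
  rwa [hA.eq_of_add_smul_eq hl (hu.trans hv.symm)]

theorem abs_inv_le {t l : ℝ} (ht : 0 ≤ t) (hl : 0 < l) : |(t + l)⁻¹| ≤ l⁻¹ := by
  rw [abs_of_nonneg (by positivity)]
  exact inv_anti₀ hl (by linarith)

theorem integrable_inv (h : IsSpectralMeasure A g μ) {l : ℝ} (hl : 0 < l) :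
    Integrable (fun t : ℝ => (t + l)⁻¹) μ := by
  have := h.finite
  refine Integrable.of_bound (by fun_prop) l⁻¹ ?_
  filter_upwards [h.ae_nonneg] with t ht using abs_inv_le ht hl

theorem integrable_inv_mul_inv (h : IsSpectralMeasure A g μ) {l m : ℝ} (hl : 0 < l)
    (hm : 0 < m) : Integrable (fun t : ℝ => (t + l)⁻¹ * (t + m)⁻¹) μ := by
  have := h.finite
  refine Integrable.of_bound (by fun_prop) (l⁻¹ * m⁻¹) ?_
  filter_upwards [h.ae_nonneg] with t ht
  rw [Real.norm_eq_abs, abs_mul]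
  exact mul_le_mul (abs_inv_le ht hl) (abs_inv_le ht hm) (abs_nonneg _) (by positivity)

/-- The norm of the resolvent is the limit of mixed products of resolvents at two different
points, which are controlled by the resolvent identity. -/
theorem norm_resolvent_sq (h : IsSpectralMeasure A g μ) (hA : IsNonnegSelfAdjoint A) {l : ℝ}
    (hl : 0 < l) {u : A.domain} (hu : A u + (l : ℂ) • (u : H) = g) :
    ‖(u : H)‖ ^ 2 = ∫ t, (t + l)⁻¹ * (t + l)⁻¹ ∂μ := by
  have hfin := h.finite
  set m : ℕ → ℝ := fun n => l + 1 / ((n : ℝ) + 1)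
  have hlm : ∀ n, l < m n := fun n => by
    have : 0 < 1 / ((n : ℝ) + 1) := Nat.one_div_pos_of_nat
    simp only [m]; linarith
  have hm0 : ∀ n, 0 < m n := fun n => hl.trans (hlm n)
  have hm : Filter.Tendsto m Filter.atTop (nhds l) := by
    simpa [m] using (tendsto_one_div_add_atTop_nhds_zero_nat (𝕜 := ℝ)).const_add l
  choose v hv hv' using fun n => h.exists_resolvent (hm0 n)
  have hmix : ∀ n, inner ℂ (u : H) (v n : H)
      = ((∫ t, (t + l)⁻¹ * (t + m n)⁻¹ ∂μ : ℝ) : ℂ) := by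
    intro n
    have h1 : inner ℂ g (v n : H) - inner ℂ (u : H) g
        = ((l - m n : ℝ) : ℂ) * inner ℂ (u : H) (v n : H) := by
      conv_lhs => rw [← hu]
      rw [hu]
      nth_rewrite 1 [← hu]
      rw [← hv n, inner_add_left, inner_add_right, hA.symm, inner_smul_left, inner_smul_right]
      simp only [Complex.conj_ofReal]
      push_cast
      ring
    have h2 : inner ℂ (u : H) g = ((∫ t, (t + l)⁻¹ ∂μ : ℝ) : ℂ) := by
      rw [← inner_conj_symm, h.inner_resolvent hA hl hu, Complex.conj_ofReal]
    rw [hv' n, h2, ← Complex.ofReal_sub, ← integral_sub (h.integrable_inv (hm0 n))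
      (h.integrable_inv hl)] at h1
    have h3 : ∫ t, ((t + m n)⁻¹ - (t + l)⁻¹) ∂μ
        = (l - m n) * ∫ t, (t + l)⁻¹ * (t + m n)⁻¹ ∂μ := by
      rw [← integral_const_mul]
      refine integral_congr_ae ?_
      filter_upwards [h.ae_nonneg] with t ht
      have := hm0 n
      have h4 : t + l ≠ 0 := by positivity
      have h5 : t + m n ≠ 0 := by positivity
      field_simp
      ring
    rw [h3, Complex.ofReal_mul] at h1
    have h6 : ((l - m n : ℝ) : ℂ) ≠ 0 := by
      have := hlm n
      exact_mod_cast (sub_neg.2 this).ne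
    exact (mul_left_cancel₀ h6 h1).symm
  have hvlim : Filter.Tendsto (fun n => (v n : H)) Filter.atTop (nhds (u : H)) := by
    rw [tendsto_iff_norm_sub_tendsto_zero]
    have hb : ∀ n, ‖(v n : H) - u‖ ≤ (m n - l) * (‖g‖ / l / l) := by
      intro n
      have h1 : A (v n - u) + (l : ℂ) • ((v n - u : A.domain) : H)
          = ((l - m n : ℝ) : ℂ) • (v n : H) := by
        have h2 : A (v n) = g - ((m n : ℝ) : ℂ) • (v n : H) := eq_sub_of_add_eq (hv n)
        have h3 : A u = g - (l : ℂ) • (u : H) := eq_sub_of_add_eq hu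
        rw [LinearPMap.map_sub, Submodule.coe_sub, h2, h3]
        push_cast
        module
      have h2 := hA.mul_norm_le (v n - u) hl.le
      have h3 := hA.mul_norm_le (v n) (hm0 n).le
      rw [hv n] at h3
      rw [h1, norm_smul, Complex.norm_real, Real.norm_eq_abs, abs_sub_comm,
        abs_of_pos (sub_pos.2 (hlm n)), Submodule.coe_sub] at h2
      have h4 : ‖(v n : H)‖ ≤ ‖g‖ / l := by
        rw [le_div_iff₀ hl]
        refine le_trans ?_ h3
        rw [mul_comm]
        have := (hlm n).le
        gcongr
      rw [mul_div_assoc', le_div_iff₀ hl, mul_comm]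
      refine h2.trans ?_
      have := sub_pos.2 (hlm n)
      gcongr
    refine squeeze_zero (fun _ => norm_nonneg _) hb ?_
    have := (hm.sub_const l).mul_const (‖g‖ / l / l)
    simpa using this
  have hlim1 : Filter.Tendsto (fun n => inner ℂ (u : H) (v n : H)) Filter.atTop
      (nhds (inner ℂ (u : H) (u : H))) := tendsto_const_nhds.inner hvlim
  have hlim2 : Filter.Tendsto (fun n => ∫ t, (t + l)⁻¹ * (t + m n)⁻¹ ∂μ) Filter.atTop
      (nhds (∫ t, (t + l)⁻¹ * (t + l)⁻¹ ∂μ)) := by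
    refine tendsto_integral_filter_of_dominated_convergence (fun _ => l⁻¹ * l⁻¹)
      (Filter.Eventually.of_forall fun n => by fun_prop)
      (Filter.Eventually.of_forall fun n => ?_) (integrable_const _) ?_
    · filter_upwards [h.ae_nonneg] with t ht
      rw [Real.norm_eq_abs, abs_mul]
      refine mul_le_mul (abs_inv_le ht hl) ((abs_inv_le ht (hm0 n)).trans ?_) (abs_nonneg _)
        (by positivity)
      exact inv_anti₀ hl (hlm n).le
    · filter_upwards [h.ae_nonneg] with t ht
      exact ((hm.const_add t).inv₀ (by positivity)).const_mul _
  have hlim3 := (Complex.continuous_ofReal.tendsto _).comp hlim2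
  have h7 := tendsto_nhds_unique hlim1 (hlim3.congr fun n => (hmix n).symm)
  rw [inner_self_eq_norm_sq_to_K] at h7
  have h8 : ((‖(u : H)‖ : ℝ) : ℂ) ^ 2 = _ := h7
  exact_mod_cast h8

variable [CompleteSpace H]

/-- The total mass of the spectral measure, from `l (A + l)⁻¹ g → g` as `l → ∞`. -/
theorem measureReal_univ (h : IsSpectralMeasure A g μ) (hA : IsNonnegSelfAdjoint A) :
    μ.real Set.univ = ‖g‖ ^ 2 := by
  have hfin := h.finite
  set m : ℕ → ℝ := fun n => (n : ℝ) + 1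
  have hm0 : ∀ n, 0 < m n := fun n => by positivity
  choose v hv hv' using fun n => h.exists_resolvent (hm0 n)
  have hvlim : Filter.Tendsto (fun n => ((m n : ℝ) : ℂ) • (v n : H)) Filter.atTop (nhds g) := by
    rw [Metric.tendsto_atTop]
    intro ε hε
    obtain ⟨w, hw, hwε⟩ := Metric.mem_closure_iff.1 (hA.dense_domain g) (ε / 3) (by positivity)
    obtain ⟨N, hN⟩ := exists_nat_gt (‖A ⟨w, hw⟩‖ / (ε / 3))
    refine ⟨N, fun n hn => ?_⟩
    have hmn : ‖A ⟨w, hw⟩‖ / m n < ε / 3 := by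
      rw [div_lt_iff₀ (by positivity)] at hN ⊢
      refine hN.trans_le ?_
      rw [mul_comm]
      have : (N : ℝ) ≤ m n := by
        have : (N : ℝ) ≤ n := by exact_mod_cast hn
        simp only [m]; linarith
      gcongr
    have hmc : ((m n : ℝ) : ℂ) ≠ 0 := by exact_mod_cast (hm0 n).ne'
    have h1 : A (v n - ((m n : ℝ) : ℂ)⁻¹ • ⟨w, hw⟩)
        + ((m n : ℝ) : ℂ) • ((v n - ((m n : ℝ) : ℂ)⁻¹ • ⟨w, hw⟩ : A.domain) : H)
        = (g - w) - ((m n : ℝ) : ℂ)⁻¹ • A ⟨w, hw⟩ := by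
      rw [LinearPMap.map_sub, LinearPMap.map_smul, Submodule.coe_sub, Submodule.coe_smul,
        eq_sub_of_add_eq (hv n), smul_sub, smul_smul, mul_inv_cancel₀ hmc]
      module
    have h2 := hA.mul_norm_le (v n - ((m n : ℝ) : ℂ)⁻¹ • ⟨w, hw⟩) (hm0 n).le
    rw [h1] at h2
    have h3 : m n * ‖((v n - ((m n : ℝ) : ℂ)⁻¹ • ⟨w, hw⟩ : A.domain) : H)‖
        = ‖((m n : ℝ) : ℂ) • (v n : H) - w‖ := by
      have : ((m n : ℝ) : ℂ) • (v n : H) - w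
          = ((m n : ℝ) : ℂ) • ((v n - ((m n : ℝ) : ℂ)⁻¹ • ⟨w, hw⟩ : A.domain) : H) := by
        rw [Submodule.coe_sub, Submodule.coe_smul, smul_sub, smul_smul, mul_inv_cancel₀ hmc,
          one_smul]
      rw [this, norm_smul, Complex.norm_real, Real.norm_of_nonneg (hm0 n).le]
    rw [h3] at h2
    have h4 : ‖(g - w) - ((m n : ℝ) : ℂ)⁻¹ • A ⟨w, hw⟩‖ ≤ ‖g - w‖ + ‖A ⟨w, hw⟩‖ / m n := by
      refine (norm_sub_le _ _).trans ?_
      rw [norm_smul, norm_inv, Complex.norm_real, Real.norm_of_nonneg (hm0 n).le,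
        inv_mul_eq_div]
    rw [dist_eq_norm] at hwε ⊢
    calc ‖((m n : ℝ) : ℂ) • (v n : H) - g‖
        = ‖(((m n : ℝ) : ℂ) • (v n : H) - w) - (g - w)‖ := by rw [sub_sub_sub_cancel_right]
      _ ≤ ‖((m n : ℝ) : ℂ) • (v n : H) - w‖ + ‖g - w‖ := norm_sub_le _ _
      _ < ε := by linarith
  have hlim1 : Filter.Tendsto (fun n => inner ℂ g (((m n : ℝ) : ℂ) • (v n : H))) Filter.atTop
      (nhds (inner ℂ g g)) := tendsto_const_nhds.inner hvlim
  have hmtop : Filter.Tendsto m Filter.atTop Filter.atTop :=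
    Filter.tendsto_atTop_add_const_right _ _ tendsto_natCast_atTop_atTop
  have hlim2 : Filter.Tendsto (fun n => ∫ t, m n * (t + m n)⁻¹ ∂μ) Filter.atTop
      (nhds (∫ _t, (1 : ℝ) ∂μ)) := by
    refine tendsto_integral_filter_of_dominated_convergence (fun _ => 1)
      (Filter.Eventually.of_forall fun n => by fun_prop)
      (Filter.Eventually.of_forall fun n => ?_) (integrable_const _) ?_
    · filter_upwards [h.ae_nonneg] with t ht
      have := hm0 n
      rw [Real.norm_of_nonneg (by positivity), ← div_eq_mul_inv, div_le_one (by positivity)]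
      linarith
    · filter_upwards [h.ae_nonneg] with t ht
      have h1 : Filter.Tendsto (fun n => 1 - t * (t + m n)⁻¹) Filter.atTop
          (nhds (1 - t * 0)) :=
        ((Filter.tendsto_atTop_add_const_left _ t hmtop).inv_tendsto_atTop.const_mul t).const_sub 1
      rw [mul_zero, sub_zero] at h1
      refine h1.congr fun n => ?_
      have := hm0 n
      field_simp
      ring
  have hlim3 := (Complex.continuous_ofReal.tendsto _).comp hlim2
  have h7 := tendsto_nhds_unique hlim1 (hlim3.congr fun n => by
    rw [Function.comp_apply, inner_smul_right, hv' n, integral_const_mul, Complex.ofReal_mul])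
  rw [inner_self_eq_norm_sq_to_K, integral_const, smul_eq_mul, mul_one] at h7
  have h8 : ((‖g‖ : ℝ) : ℂ) ^ 2 = _ := h7
  exact_mod_cast h8.symm

theorem norm_apply_resolvent_sq (h : IsSpectralMeasure A g μ) (hA : IsNonnegSelfAdjoint A)
    {l : ℝ} (hl : 0 < l) {u : A.domain} (hu : A u + (l : ℂ) • (u : H) = g) :
    ‖A u‖ ^ 2 = ∫ t, (t / (t + l)) ^ 2 ∂μ := by
  have hfin := h.finite
  have h1 : A u = g + ((-l : ℝ) : ℂ) • (u : H) := by
    rw [← hu]; push_cast; module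
  have h2 : ∫ t, (t / (t + l)) ^ 2 ∂μ
      = ∫ t, ((1 - 2 * l * (t + l)⁻¹) + l ^ 2 * ((t + l)⁻¹ * (t + l)⁻¹)) ∂μ := by
    refine integral_congr_ae ?_
    filter_upwards [h.ae_nonneg] with t ht
    field_simp
    ring
  have h3 : Integrable (fun t => 2 * l * (t + l)⁻¹) μ := (h.integrable_inv hl).const_mul _
  have h4 : Integrable (fun t => 1 - 2 * l * (t + l)⁻¹) μ := (integrable_const _).sub h3
  rw [h2, integral_add h4 ((h.integrable_inv_mul_inv hl hl).const_mul _),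
    integral_sub (integrable_const _) h3, integral_const_mul, integral_const_mul,
    ← h.norm_resolvent_sq hA hl hu, integral_const, h.measureReal_univ hA, h1,
    norm_add_sq (𝕜 := ℂ), inner_smul_right, h.inner_resolvent hA hl hu, norm_smul]
  simp only [RCLike.re_to_complex, Complex.mul_re, Complex.ofReal_re, Complex.ofReal_im,
    Complex.norm_real, mul_pow, Real.norm_eq_abs, sq_abs, smul_eq_mul]
  ring

end IsSpectralMeasure

variable [CompleteSpace H]

/-- Membership in the domain of `A^{s/2}` is the summability of `4^{ns} ‖A (A + 4^n)⁻¹ g‖²`. -/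
theorem mem_powerDomain_iff_summable (hA : IsNonnegSelfAdjoint A) {s : ℝ} (hs0 : 0 < s)
    (hs2 : s < 2) {u : ℕ → A.domain}
    (hu : ∀ n, A (u n) + ((4 ^ n : ℝ) : ℂ) • (u n : H) = g) :
    g ∈ powerDomain A (s / 2) ↔ Summable fun n => ((2 ^ s : ℝ) ^ n * ‖A (u n)‖) ^ 2 := by
  have key : ∀ μ, IsSpectralMeasure A g μ → (MemLp (fun t : ℝ => t ^ (s / 2)) 2 μ ↔
      Summable fun n => ((2 ^ s : ℝ) ^ n * ‖A (u n)‖) ^ 2) := by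
    intro μ hμ
    have := hμ.finite
    rw [← integrable_rpow_iff_summable (T := fun t : ℝ => t) measurable_id hμ.ae_nonneg hs0 hs2
        (fun n => hμ.norm_apply_resolvent_sq hA (by positivity) (hu n)),
      memLp_two_iff_integrable_sq (by fun_prop)]
    refine integrable_congr ?_
    filter_upwards [hμ.ae_nonneg] with t ht
    rw [← Real.rpow_mul_natCast ht]
    congr 1
    push_cast
    ring
  constructor
  · rintro ⟨μ, hμ, h⟩
    exact (key μ hμ).1 h
  · intro h
    obtain ⟨μ, hμ⟩ := hA.exists_isSpectralMeasure g
    exact ⟨μ, hμ, (key μ hμ).2 h⟩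

end AbstractSpectral

open FourierTransform

/-! ### The Fourier transform on `L²(ℝ³)` -/

theorem locallyIntegrable_coeFn (f : L2) : LocallyIntegrable (f : R3 → ℂ) volume :=
  (Lp.memLp f).locallyIntegrable (by norm_num)

theorem ae_eq_of_integral_schwartz {f g : R3 → ℂ} (hf : LocallyIntegrable f volume)
    (hg : LocallyIntegrable g volume)
    (h : ∀ φ : 𝓢(R3, ℂ), ∫ x, φ x • f x = ∫ x, φ x • g x) : f =ᵐ[volume] g := by
  refine ae_eq_of_integral_contDiff_smul_eq hf hg fun φ hφ hφc => ?_
  have h1 : HasCompactSupport (Complex.ofRealCLM ∘ φ) := hφc.comp_left rfl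
  have h2 : ContDiff ℝ ((⊤ : ℕ∞) : WithTop ℕ∞) (Complex.ofRealCLM ∘ φ) := by fun_prop
  simpa using h (h1.toSchwartzMap h2)

/-- Multiplication of a distribution in `L²` by a function of temperate growth. -/
theorem smulLeftCLM_eq_iff {m : R3 → ℂ} (hm : m.HasTemperateGrowth) (f g : L2) :
    TemperedDistribution.smulLeftCLM ℂ m (f : 𝓢'(R3, ℂ)) = (g : 𝓢'(R3, ℂ)) ↔
      (g : R3 → ℂ) =ᵐ[volume] fun ξ => m ξ * f ξ := by
  have key : ∀ φ : 𝓢(R3, ℂ), TemperedDistribution.smulLeftCLM ℂ m (f : 𝓢'(R3, ℂ)) φ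
      = ∫ x, φ x • (m x * f x) := by
    intro φ
    rw [TemperedDistribution.smulLeftCLM_apply_apply, Lp.toTemperedDistribution_apply]
    refine integral_congr_ae (Filter.Eventually.of_forall fun x => ?_)
    simp only [SchwartzMap.smulLeftCLM_apply_apply hm, smul_eq_mul]
    ring
  constructor
  · intro h
    refine ae_eq_of_integral_schwartz (locallyIntegrable_coeFn g)
      ((locallyIntegrable_coeFn f).continuous_mul hm.1.continuous) fun φ => ?_
    rw [← key, h, Lp.toTemperedDistribution_apply]
  · intro h
    ext φ
    rw [key, Lp.toTemperedDistribution_apply]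
    refine integral_congr_ae ?_
    filter_upwards [h] with x hx
    rw [hx]

theorem fourier_ae_eq_of_integrable {f : L2} (hf : Integrable (f : R3 → ℂ)) :
    (𝓕 f : L2) =ᵐ[volume] 𝓕 (f : R3 → ℂ) := by
  have hc : Continuous (𝓕 (f : R3 → ℂ)) :=
    VectorFourier.fourierIntegral_continuous Real.continuous_fourierChar
      (innerSL ℝ).continuous₂ hf
  refine ae_eq_of_integral_schwartz (locallyIntegrable_coeFn _) hc.locallyIntegrable fun φ => ?_
  have h1 : ((𝓕 f : L2) : 𝓢'(R3, ℂ)) φ = (f : 𝓢'(R3, ℂ)) (𝓕 φ) := by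
    rw [← Lp.fourier_toTemperedDistribution_eq, TemperedDistribution.fourier_apply]
  rw [Lp.toTemperedDistribution_apply, Lp.toTemperedDistribution_apply] at h1
  rw [h1]
  simpa using! VectorFourier.integral_fourierIntegral_smul_eq_flip (L := innerₗ R3)
    Real.continuous_fourierChar continuous_inner φ.integrable hf

theorem ae_eq_fourierInv_of_integrable {f : L2} (hf : Integrable ((𝓕 f : L2) : R3 → ℂ)) :
    (f : R3 → ℂ) =ᵐ[volume] 𝓕⁻ ((𝓕 f : L2) : R3 → ℂ) := by
  set g : L2 := 𝓕 f with hg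
  have hc : Continuous (𝓕⁻ (g : R3 → ℂ)) :=
    VectorFourier.fourierIntegral_continuous Real.continuous_fourierChar
      (L := -innerₗ R3) (by simpa using! continuous_inner.neg) hf
  refine ae_eq_of_integral_schwartz (locallyIntegrable_coeFn _) hc.locallyIntegrable fun φ => ?_
  have h1 : (f : 𝓢'(R3, ℂ)) φ = (g : 𝓢'(R3, ℂ)) (𝓕⁻ φ) := by
    have h2 : (𝓕⁻ g : L2) = f := (Lp.fourierTransformₗᵢ R3 ℂ).symm_apply_apply f
    rw [← TemperedDistribution.fourierInv_apply (g : 𝓢'(R3, ℂ)) φ,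
      Lp.fourierInv_toTemperedDistribution_eq, h2]
  rw [Lp.toTemperedDistribution_apply, Lp.toTemperedDistribution_apply] at h1
  rw [h1]
  have hflip : (-innerₗ R3).flip = -innerₗ R3 := by
    ext x y
    simp [real_inner_comm]
  have h3 := VectorFourier.integral_fourierIntegral_smul_eq_flip (μ := volume) (ν := volume)
    (L := -innerₗ R3) Real.continuous_fourierChar (by simpa using! continuous_inner.neg)
    (φ.integrable (μ := volume)) hf
  rw [hflip] at h3
  rw [SchwartzMap.fourierInv_coe]
  exact h3

theorem HasValueAtZero.unique {f : L2} {v w : ℂ} (hv : HasValueAtZero f v)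
    (hw : HasValueAtZero f w) : v = w := by
  obtain ⟨F, hF, hfF, rfl⟩ := hv
  obtain ⟨G, hG, hfG, rfl⟩ := hw
  rw [(hF.ae_eq_iff_eq volume hG).1 (hfF.symm.trans hfG)]

/-- If the Fourier transform is integrable, the value at the origin is its integral. -/
theorem hasValueAtZero_of_integrable_fourier {f : L2}
    (hf : Integrable ((𝓕 f : L2) : R3 → ℂ)) :
    HasValueAtZero f (∫ ξ, (𝓕 f : L2) ξ) := by
  refine ⟨𝓕⁻ ((𝓕 f : L2) : R3 → ℂ), ?_, ae_eq_fourierInv_of_integrable hf, ?_⟩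
  · exact VectorFourier.fourierIntegral_continuous Real.continuous_fourierChar
      (L := -innerₗ R3) (by simpa using! continuous_inner.neg) hf
  · rw [Real.fourierInv_eq]
    simp

theorem eq_of_fourier_ae_eq {f g : L2} (h : (𝓕 f : L2) =ᵐ[volume] (𝓕 g : L2)) : f = g :=
  (Lp.fourierTransformₗᵢ R3 ℂ).injective (Lp.ext h)

theorem fourier_sub (f g : L2) : (𝓕 (f - g) : L2) = 𝓕 f - 𝓕 g :=
  map_sub (Lp.fourierTransformₗᵢ R3 ℂ) f g

theorem norm_sq_eq_integral_fourier (f : L2) :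
    ‖f‖ ^ 2 = ∫ ξ, ‖(𝓕 f : L2) ξ‖ ^ 2 := by
  rw [← Lp.norm_fourier_eq, ← inner_self_eq_norm_sq (𝕜 := ℂ), L2.inner_def]
  rw [← integral_re (L2.integrable_inner _ _)]
  exact integral_congr_ae (Filter.Eventually.of_forall fun ξ => inner_self_eq_norm_sq (𝕜 := ℂ) _)

theorem integrable_norm_sq_fourier (f : L2) :
    Integrable (fun ξ => ‖(𝓕 f : L2) ξ‖ ^ 2) (volume : Measure R3) :=
  (memLp_two_iff_integrable_sq_norm (Lp.aestronglyMeasurable _)).1 (Lp.memLp _)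

theorem mem_sobolev_iff_memLp {s : ℝ} {f : L2} :
    f ∈ sobolev s ↔ MemLp (fun ξ => (((1 + ‖ξ‖ ^ 2) ^ (s / 2) : ℝ) : ℂ) * (𝓕 f : L2) ξ) 2
      (volume : Measure R3) := by
  change TemperedDistribution.MemSobolev s 2 (f : 𝓢'(R3, ℂ)) ↔ _
  rw [TemperedDistribution.memSobolev_iff_exists_smulLeftCLM_fourier,
    Lp.fourier_toTemperedDistribution_eq]
  have ht : (fun x : R3 => (((1 + ‖x‖ ^ 2) ^ (s / 2) : ℝ) : ℂ)).HasTemperateGrowth := by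
    fun_prop
  simp_rw [smulLeftCLM_eq_iff ht]
  constructor
  · rintro ⟨f', hf'⟩
    exact (memLp_congr_ae hf').1 (Lp.memLp f')
  · intro h
    exact ⟨h.toLp, h.coeFn_toLp⟩

/-- The symbol `4π²|ξ|²` of `-Δ`. -/
def symb (ξ : R3) : ℝ := (2 * Real.pi) ^ 2 * ‖ξ‖ ^ 2

theorem symb_nonneg (ξ : R3) : 0 ≤ symb ξ := by unfold symb; positivity

@[fun_prop]
theorem continuous_symb : Continuous symb := by unfold symb; fun_prop

theorem symb_add_pos {l : ℝ} (hl : 0 < l) (ξ : R3) : 0 < symb ξ + l := by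
  have := symb_nonneg ξ; linarith

theorem symb_add_ne {l : ℝ} (hl : 0 < l) (ξ : R3) : (((symb ξ + l : ℝ)) : ℂ) ≠ 0 := by
  exact_mod_cast (symb_add_pos hl ξ).ne'

/-- A function lies in `H^s` if and only if `(4π²|ξ|²)^s |f̂(ξ)|²` is integrable. -/
theorem mem_sobolev_iff_integrable {s : ℝ} (hs : 0 < s) {f : L2} :
    f ∈ sobolev s ↔
      Integrable (fun ξ => symb ξ ^ s * ‖(𝓕 f : L2) ξ‖ ^ 2) (volume : Measure R3) := by
  have hm : AEStronglyMeasurable ((𝓕 f : L2) : R3 → ℂ) volume := Lp.aestronglyMeasurable _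
  have hsm : Measurable fun ξ : R3 => symb ξ ^ s := continuous_symb.measurable.pow_const s
  have hjm : Measurable fun ξ : R3 => ((1 + ‖ξ‖ ^ 2) ^ s : ℝ) := by fun_prop
  have hpi : 1 ≤ 2 * Real.pi := by have := Real.pi_gt_three; linarith
  rw [mem_sobolev_iff_memLp, memLp_two_iff_integrable_sq_norm (by
    refine AEStronglyMeasurable.mul ?_ hm
    exact Measurable.aestronglyMeasurable (by fun_prop))]
  have heq : (fun ξ : R3 => ‖(((1 + ‖ξ‖ ^ 2) ^ (s / 2) : ℝ) : ℂ) * (𝓕 f : L2) ξ‖ ^ 2)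
      = fun ξ => ((1 + ‖ξ‖ ^ 2) ^ s : ℝ) * ‖(𝓕 f : L2) ξ‖ ^ 2 := by
    ext ξ
    rw [norm_mul, mul_pow, Complex.norm_real, Real.norm_of_nonneg (by positivity),
      ← Real.rpow_mul_natCast (by positivity)]
    congr 2
    push_cast
    ring
  rw [heq]
  constructor
  · intro h
    refine (h.const_mul (((2 * Real.pi) ^ 2) ^ s)).mono'
      (hsm.aestronglyMeasurable.mul (hm.norm.pow 2)) (Filter.Eventually.of_forall fun ξ => ?_)
    have hsy := symb_nonneg ξ
    rw [Real.norm_of_nonneg (by positivity), ← mul_assoc, ← Real.mul_rpow (by positivity)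
      (by positivity)]
    gcongr
    unfold symb
    gcongr
    linarith
  · intro h
    refine ((h.add (integrable_norm_sq_fourier f)).const_mul (2 ^ s)).mono'
      (hjm.aestronglyMeasurable.mul (hm.norm.pow 2)) (Filter.Eventually.of_forall fun ξ => ?_)
    have hsy := symb_nonneg ξ
    rw [Real.norm_of_nonneg (by positivity)]
    simp only [Pi.add_apply]
    rw [← add_one_mul, ← mul_assoc]
    gcongr
    have h1 : 1 + ‖ξ‖ ^ 2 ≤ 2 * max (symb ξ) 1 := by
      have h2 : ‖ξ‖ ^ 2 ≤ symb ξ := by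
        unfold symb
        exact le_mul_of_one_le_left (sq_nonneg _) (one_le_pow₀ hpi)
      have := le_max_left (symb ξ) 1
      have := le_max_right (symb ξ) 1
      linarith
    calc ((1 + ‖ξ‖ ^ 2) ^ s : ℝ) ≤ (2 * max (symb ξ) 1) ^ s :=
          Real.rpow_le_rpow (by positivity) h1 hs.le
      _ = 2 ^ s * (max (symb ξ) 1) ^ s := Real.mul_rpow (by norm_num) (by positivity)
      _ ≤ 2 ^ s * (symb ξ ^ s + 1) := by
        gcongr
        rcases le_total (symb ξ) 1 with h3 | h3
        · rw [max_eq_right h3, Real.one_rpow]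
          have := Real.rpow_nonneg hsy s
          linarith
        · rw [max_eq_left h3]
          linarith

/-- The Sobolev embedding: the Fourier transform of a function in `H^s` with `s > 3/2` is
integrable. -/
theorem integrable_fourier_of_mem_sobolev {s : ℝ} (hs : 3 / 2 < s) {f : L2}
    (hf : f ∈ sobolev s) : Integrable ((𝓕 f : L2) : R3 → ℂ) := by
  rw [mem_sobolev_iff_memLp] at hf
  have h1 : MemLp (fun x : R3 => (((1 + ‖x‖ ^ 2) ^ (-s / 2) : ℝ) : ℂ)) 2 volume := by
    suffices h0 : MemLp (fun x : R3 => ((1 + ‖x‖ ^ 2) ^ (-s / 2) : ℝ)) 2 volume from h0.ofReal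
    rw [memLp_two_iff_integrable_sq (Measurable.aestronglyMeasurable (by fun_prop))]
    have h2 := integrable_rpow_neg_one_add_norm_sq (E := R3) (μ := volume) (r := 2 * s)
      (by rw [finrank_euclideanSpace_fin]; push_cast; linarith)
    refine h2.congr (Filter.Eventually.of_forall fun x => ?_)
    simp only
    rw [← Real.rpow_mul_natCast (by positivity)]
    congr 1
    push_cast
    ring
  have h3 := h1.integrable_mul hf
  refine h3.congr (Filter.Eventually.of_forall fun x => ?_)
  simp only [Pi.mul_apply]
  rw [← mul_assoc, ← Complex.ofReal_mul, ← Real.rpow_add (by positivity)]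
  have : -s / 2 + s / 2 = 0 := by ring
  rw [this, Real.rpow_zero, Complex.ofReal_one, one_mul]

/-! ### The resolvent of the free Laplacian -/

theorem memLp_freeRes {l : ℝ} (hl : 0 < l) (g : L2) :
    MemLp (fun ξ => ((symb ξ + l : ℝ) : ℂ)⁻¹ * (𝓕 g : L2) ξ) 2 (volume : Measure R3) := by
  have hm : AEStronglyMeasurable (fun ξ : R3 => ((symb ξ + l : ℝ) : ℂ)⁻¹) volume :=
    Measurable.aestronglyMeasurable (by fun_prop)
  refine MemLp.of_le_mul (c := l⁻¹) (Lp.memLp (𝓕 g : L2))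
    (hm.mul (Lp.aestronglyMeasurable _)) (Filter.Eventually.of_forall fun ξ => ?_)
  rw [norm_mul, norm_inv, Complex.norm_real, Real.norm_of_nonneg (symb_add_pos hl ξ).le]
  have := symb_nonneg ξ
  gcongr
  linarith

/-- The resolvent `(-Δ + l)⁻¹`, as the Fourier multiplier with symbol `1 / (4π²|ξ|² + l)`. -/
def freeRes (l : ℝ) (hl : 0 < l) : L2 →ₗ[ℂ] L2 where
  toFun g := 𝓕⁻ ((memLp_freeRes hl g).toLp)
  map_add' g g' := by
    rw [← FourierTransform.fourierInv_add]
    congr 1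
    rw [← MemLp.toLp_add]
    refine MemLp.toLp_congr _ _ ?_
    rw [FourierTransform.fourier_add]
    filter_upwards [Lp.coeFn_add (𝓕 g : L2) (𝓕 g')] with ξ h
    simp only [Pi.add_apply, h]
    ring
  map_smul' c g := by
    rw [RingHom.id_apply, ← FourierTransform.fourierInv_smul]
    congr 1
    rw [← MemLp.toLp_const_smul]
    refine MemLp.toLp_congr _ _ ?_
    rw [FourierTransform.fourier_smul]
    filter_upwards [Lp.coeFn_smul c (𝓕 g : L2)] with ξ h
    simp only [Pi.smul_apply, h, smul_eq_mul]
    ring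

theorem fourier_freeRes {l : ℝ} (hl : 0 < l) (g : L2) :
    (𝓕 (freeRes l hl g) : L2) =ᵐ[volume] fun ξ => ((symb ξ + l : ℝ) : ℂ)⁻¹ * (𝓕 g : L2) ξ := by
  have : (𝓕 (freeRes l hl g) : L2) = (memLp_freeRes hl g).toLp := by
    simp only [freeRes, LinearMap.coe_mk, AddHom.coe_mk]
    exact FourierTransform.fourier_fourierInv_eq _
  rw [this]
  exact MemLp.coeFn_toLp _

theorem fourier_sub_smul (f g : L2) (c : ℂ) :
    (𝓕 (f - c • g) : L2) =ᵐ[volume] fun ξ => (𝓕 f : L2) ξ - c * (𝓕 g : L2) ξ := by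
  rw [fourier_sub, FourierTransform.fourier_smul]
  filter_upwards [Lp.coeFn_sub (𝓕 f : L2) (c • 𝓕 g), Lp.coeFn_smul c (𝓕 g : L2)] with ξ h1 h2
  rw [h1, Pi.sub_apply, h2, Pi.smul_apply, smul_eq_mul]

theorem norm_sub_smul_freeRes_sq {l : ℝ} (hl : 0 < l) (m : ℝ) (g : L2) :
    ‖g - (m : ℂ) • freeRes l hl g‖ ^ 2
      = ∫ ξ, ((symb ξ + l - m) / (symb ξ + l)) ^ 2 * ‖(𝓕 g : L2) ξ‖ ^ 2 := by
  rw [norm_sq_eq_integral_fourier]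
  refine integral_congr_ae ?_
  filter_upwards [fourier_sub_smul g (freeRes l hl g) m, fourier_freeRes hl g] with ξ h1 h2
  rw [h1, h2, ← mul_pow, ← sq_abs (_ * _), abs_mul, abs_norm, ← Real.norm_eq_abs,
    ← Complex.norm_real, ← norm_mul]
  congr 2
  have := symb_add_ne hl ξ
  push_cast at this ⊢
  field_simp

/-- The operator `1 - m (-Δ + l)⁻¹`, with symbol `(4π²|ξ|² + l - m) / (4π²|ξ|² + l)`, is a
contraction for `0 ≤ m ≤ l`. -/
theorem norm_sub_smul_freeRes_le {l m : ℝ} (hl : 0 < l) (hm0 : 0 ≤ m) (hml : m ≤ l) (g : L2) :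
    ‖g - (m : ℂ) • freeRes l hl g‖ ≤ ‖g‖ := by
  refine le_of_sq_le_sq ?_ (norm_nonneg _)
  rw [norm_sub_smul_freeRes_sq, norm_sq_eq_integral_fourier]
  refine integral_mono_of_nonneg (Filter.Eventually.of_forall fun ξ => by positivity)
    (integrable_norm_sq_fourier g) (Filter.Eventually.of_forall fun ξ => ?_)
  simp only
  refine mul_le_of_le_one_left (sq_nonneg _) (pow_le_one₀ ?_ ?_)
  · have := symb_add_pos hl ξ
    have := symb_nonneg ξ
    exact div_nonneg (by linarith) (by linarith)
  · rw [div_le_one (symb_add_pos hl ξ)]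
    linarith

theorem mul_norm_freeRes_le {l : ℝ} (hl : 0 < l) (g : L2) :
    l * ‖freeRes l hl g‖ ≤ ‖g‖ := by
  refine le_of_sq_le_sq ?_ (norm_nonneg _)
  rw [mul_pow, norm_sq_eq_integral_fourier, norm_sq_eq_integral_fourier g, ← integral_const_mul]
  refine integral_mono_of_nonneg (Filter.Eventually.of_forall fun ξ => by positivity)
    (integrable_norm_sq_fourier g) ?_
  filter_upwards [fourier_freeRes hl g] with ξ h
  rw [h, norm_mul, norm_inv, Complex.norm_real, Real.norm_of_nonneg (symb_add_pos hl ξ).le,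
    ← mul_pow, ← mul_assoc]
  refine pow_le_pow_left₀ (by have := symb_add_pos hl ξ; positivity) ?_ 2
  refine mul_le_of_le_one_left (norm_nonneg _) ?_
  have := symb_nonneg ξ
  rw [← div_eq_mul_inv, div_le_one (symb_add_pos hl ξ)]
  linarith

theorem inner_freeRes_left {l : ℝ} (hl : 0 < l) (f g : L2) :
    inner ℂ (freeRes l hl f) g = inner ℂ f (freeRes l hl g) := by
  rw [← Lp.inner_fourier_eq, ← Lp.inner_fourier_eq f, L2.inner_def, L2.inner_def]
  refine integral_congr_ae ?_
  filter_upwards [fourier_freeRes hl f, fourier_freeRes hl g] with ξ h1 h2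
  rw [h1, h2]
  simp only [RCLike.inner_apply, map_mul, map_inv₀, Complex.conj_ofReal]
  ring

theorem re_inner_freeRes_nonneg {l : ℝ} (hl : 0 < l) (g : L2) :
    0 ≤ (inner ℂ g (freeRes l hl g)).re := by
  rw [← Lp.inner_fourier_eq, L2.inner_def]
  change 0 ≤ RCLike.re (K := ℂ) _
  rw [← integral_re (L2.integrable_inner _ _)]
  refine integral_nonneg_of_ae ?_
  filter_upwards [fourier_freeRes hl g] with ξ h
  rw [h]
  have h1 : inner ℂ ((𝓕 g : L2) ξ) (((symb ξ + l : ℝ) : ℂ)⁻¹ * (𝓕 g : L2) ξ)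
      = (((symb ξ + l)⁻¹ * ‖(𝓕 g : L2) ξ‖ ^ 2 : ℝ) : ℂ) := by
    rw [RCLike.inner_apply, mul_assoc, RCLike.mul_conj]
    push_cast
    rfl
  have := symb_add_pos hl ξ
  simp only [Pi.zero_apply]
  rw [h1, RCLike.re_to_complex, Complex.ofReal_re]
  positivity

/-- The first resolvent identity. -/
theorem freeRes_freeRes {l m : ℝ} (hl : 0 < l) (hm : 0 < m) (g : L2) :
    ((m - l : ℝ) : ℂ) • freeRes l hl (freeRes m hm g) = freeRes l hl g - freeRes m hm g := by
  refine eq_of_fourier_ae_eq ?_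
  rw [fourier_sub, FourierTransform.fourier_smul]
  filter_upwards [fourier_freeRes hl g, fourier_freeRes hm g, fourier_freeRes hl (freeRes m hm g),
    Lp.coeFn_sub (𝓕 (freeRes l hl g) : L2) (𝓕 (freeRes m hm g)),
    Lp.coeFn_smul ((m - l : ℝ) : ℂ) (𝓕 (freeRes l hl (freeRes m hm g)) : L2)] with ξ h1 h2 h3 h4 h5
  rw [h5, h4, Pi.smul_apply, Pi.sub_apply, h1, h3, h2, smul_eq_mul]
  have a1 := symb_add_ne hl ξ
  have a2 := symb_add_ne hm ξ
  push_cast at a1 a2 ⊢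
  field_simp
  ring

/-- The dyadic characterization of the Sobolev spaces through the free resolvent. -/
theorem mem_sobolev_iff_summable {s : ℝ} (hs0 : 0 < s) (hs2 : s < 2) {f : L2} :
    f ∈ sobolev s ↔ Summable fun n : ℕ =>
      ((2 ^ s : ℝ) ^ n * ‖f - ((4 ^ n : ℝ) : ℂ) • freeRes (4 ^ n) (by positivity) f‖) ^ 2 := by
  set w : R3 → NNReal := fun ξ => ‖(𝓕 f : L2) ξ‖₊ ^ 2 with hw
  have hwm : AEMeasurable w volume :=
    (Lp.aestronglyMeasurable (𝓕 f : L2)).nnnorm.aemeasurable.pow_const 2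
  set ν : Measure R3 := volume.withDensity fun ξ => (w ξ : ℝ≥0∞)
  have hint := integrable_norm_sq_fourier f
  have hν : IsFiniteMeasure ν := by
    refine isFiniteMeasure_withDensity (ne_of_lt ?_)
    have h1 := hint.2
    rw [hasFiniteIntegral_iff_enorm] at h1
    refine lt_of_le_of_lt (lintegral_mono fun ξ => ?_) h1
    simp [w, enorm_eq_nnnorm]
  rw [mem_sobolev_iff_integrable hs0, ← integrable_rpow_iff_summable (ν := ν) (T := symb)
    continuous_symb.measurable (Filter.Eventually.of_forall symb_nonneg) hs0 hs2]
  · rw [integrable_withDensity_iff_integrable_smul₀ hwm]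
    refine integrable_congr (Filter.Eventually.of_forall fun ξ => ?_)
    simp only [w, NNReal.smul_def, NNReal.coe_pow, coe_nnnorm, smul_eq_mul]
    ring
  · intro n
    rw [norm_sub_smul_freeRes_sq, integral_withDensity_eq_integral_smul₀ hwm]
    refine integral_congr_ae (Filter.Eventually.of_forall fun ξ => ?_)
    simp only [w, NNReal.smul_def, NNReal.coe_pow, coe_nnnorm, smul_eq_mul, add_sub_cancel_right]
    ring

/-- The equation `(-Δ + l) f = w` with `f ∈ H²`, solved by the free resolvent. -/
theorem mem_sobolev_two_and_eq_iff {l : ℝ} (hl : 0 < l) {f w : L2} :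
    (f ∈ sobolev 2 ∧ (w : 𝓢'(R3, ℂ)) = -Δ (f : 𝓢'(R3, ℂ)) + (l : ℂ) • (f : 𝓢'(R3, ℂ))) ↔
      f = freeRes l hl w := by
  have ht : (fun ξ : R3 => ((symb ξ + l : ℝ) : ℂ)).HasTemperateGrowth := by
    unfold symb
    fun_prop
  have ht2 : (fun ξ : R3 => ((‖ξ‖ ^ 2 : ℝ) : ℂ)).HasTemperateGrowth := by fun_prop
  have heq : (w : 𝓢'(R3, ℂ)) = -Δ (f : 𝓢'(R3, ℂ)) + (l : ℂ) • (f : 𝓢'(R3, ℂ)) ↔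
      ((𝓕 w : L2) : R3 → ℂ) =ᵐ[volume] fun ξ => ((symb ξ + l : ℝ) : ℂ) * (𝓕 f : L2) ξ := by
    rw [← smulLeftCLM_eq_iff ht, ← Lp.fourier_toTemperedDistribution_eq,
      ← Lp.fourier_toTemperedDistribution_eq]
    have h1 : TemperedDistribution.smulLeftCLM ℂ (fun ξ : R3 => ((symb ξ + l : ℝ) : ℂ))
        (𝓕 (f : 𝓢'(R3, ℂ))) = 𝓕 (-Δ (f : 𝓢'(R3, ℂ)) + (l : ℂ) • (f : 𝓢'(R3, ℂ))) := by
      rw [TemperedDistribution.laplacian_eq_fourierMultiplierCLM, FourierTransform.fourier_add,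
        FourierTransform.fourier_smul, neg_smul, neg_neg,
        TemperedDistribution.fourierMultiplierCLM_apply]
      have h2 : (fun ξ : R3 => ((symb ξ + l : ℝ) : ℂ))
          = (((2 * Real.pi) ^ 2 : ℝ) : ℂ) • (fun ξ : R3 => ((‖ξ‖ ^ 2 : ℝ) : ℂ))
            + fun _ => (l : ℂ) := by
        ext ξ
        simp [symb]
      rw [h2, TemperedDistribution.smulLeftCLM_add (by fun_prop) (by fun_prop),
        TemperedDistribution.smulLeftCLM_smul ht2, ← Complex.coe_smul, FourierTransform.fourier_smul,
        FourierTransform.fourier_fourierInv_eq]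
      simp only [_root_.add_apply, _root_.smul_apply, TemperedDistribution.smulLeftCLM_const]
    rw [h1]
    constructor
    · intro h; rw [h]
    · intro h
      have := congrArg (fun u : 𝓢'(R3, ℂ) => 𝓕⁻ u) h
      simpa only [FourierTransform.fourierInv_fourier_eq] using this.symm
  rw [heq]
  constructor
  · rintro ⟨-, h⟩
    refine eq_of_fourier_ae_eq ?_
    filter_upwards [h, fourier_freeRes hl w] with ξ h1 h2
    rw [h2, h1, inv_mul_cancel_left₀ (symb_add_ne hl ξ)]
  · intro h
    have h1 : ((𝓕 w : L2) : R3 → ℂ) =ᵐ[volume] fun ξ => ((symb ξ + l : ℝ) : ℂ) * (𝓕 f : L2) ξ := by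
      filter_upwards [fourier_freeRes hl w] with ξ h2
      rw [h, h2, mul_inv_cancel_left₀ (symb_add_ne hl ξ)]
    refine ⟨?_, h1⟩
    rw [mem_sobolev_iff_integrable two_pos]
    refine (integrable_norm_sq_fourier w).mono' ?_ ?_
    · exact ((continuous_symb.measurable.pow_const _).aestronglyMeasurable).mul
        ((Lp.aestronglyMeasurable _).norm.pow 2)
    · filter_upwards [h1] with ξ h2
      have := symb_nonneg ξ
      rw [Real.norm_of_nonneg (by positivity), h2, norm_mul, Complex.norm_real,
        Real.norm_of_nonneg (symb_add_pos hl ξ).le, mul_pow, Real.rpow_two]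
      gcongr
      linarith

/-! ### The Fourier transform of the Green function -/

theorem integrable_greenFun {l : ℝ} (hl : 0 < l) :
    Integrable (greenFun l) (volume : Measure R3) := by
  set μ := Real.sqrt l
  have hμ : 0 < μ := Real.sqrt_pos.2 hl
  have key : Integrable (fun x : R3 =>
      (fun r : ℝ => Real.exp (-μ * r) / (4 * Real.pi * r)) ‖x‖) volume := by
    refine (integrable_fun_norm_addHaar (volume : Measure R3)
      (f := fun r : ℝ => Real.exp (-μ * r) / (4 * Real.pi * r))).2 ?_
    have hfin : Module.finrank ℝ R3 - 1 = 2 := by simp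
    rw [hfin]
    have hi := (integrableOn_exp_mul_Ioi (a := -(μ / 2)) (by linarith) 0).const_mul
      (1 / (4 * Real.pi) * (2 / μ))
    refine hi.mono' (Measurable.aestronglyMeasurable (by fun_prop)) ?_
    refine (ae_restrict_iff' measurableSet_Ioi).2 (Filter.Eventually.of_forall fun r hr => ?_)
    have hr' : 0 < r := hr
    have hp := Real.pi_pos
    rw [Real.norm_of_nonneg (by rw [smul_eq_mul]; positivity), smul_eq_mul]
    have h1 : r ^ 2 * (Real.exp (-μ * r) / (4 * Real.pi * r))
        = 1 / (4 * Real.pi) * (r * Real.exp (-(μ / 2) * r)) * Real.exp (-(μ / 2) * r) := by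
      have : Real.exp (-μ * r) = Real.exp (-(μ / 2) * r) * Real.exp (-(μ / 2) * r) := by
        rw [← Real.exp_add]; congr 1; ring
      rw [this]
      field_simp
    rw [h1]
    gcongr
    have h2 : μ / 2 * r ≤ Real.exp (μ / 2 * r) := by
      have := Real.add_one_le_exp (μ / 2 * r); linarith
    calc r * Real.exp (-(μ / 2) * r) = 2 / μ * (μ / 2 * r * Real.exp (-(μ / 2) * r)) := by
          field_simp
      _ ≤ 2 / μ * (Real.exp (μ / 2 * r) * Real.exp (-(μ / 2) * r)) := by gcongr
      _ = 2 / μ := by rw [← Real.exp_add]; simp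
  exact key.ofReal

/-- The integral of the Green function over a plane at distance `|a|` from the origin. -/
theorem integral_green_plane {μ : ℝ} (hμ : 0 < μ) (a : ℝ) :
    ∫ y : Fin 2 → ℝ, Real.exp (-μ * √(a ^ 2 + ∑ i, y i ^ 2)) /
      (4 * Real.pi * √(a ^ 2 + ∑ i, y i ^ 2)) = Real.exp (-μ * |a|) / (2 * μ) := by
  have hp := Real.pi_pos
  have h1 := (EuclideanSpace.volume_preserving_symm_measurableEquiv_toLp (Fin 2)).integral_comp'
    (fun y : Fin 2 → ℝ => Real.exp (-μ * √(a ^ 2 + ∑ i, y i ^ 2)) /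
      (4 * Real.pi * √(a ^ 2 + ∑ i, y i ^ 2)))
  rw [← h1]
  have h2 : ∀ y : EuclideanSpace ℝ (Fin 2),
      ∑ i, ((MeasurableEquiv.toLp 2 (Fin 2 → ℝ)).symm y i) ^ 2 = ‖y‖ ^ 2 := by
    intro y
    rw [EuclideanSpace.norm_sq_eq]
    simp
  simp_rw [h2]
  rw [integral_fun_norm_addHaar (volume : Measure (EuclideanSpace ℝ (Fin 2)))
    (fun r => Real.exp (-μ * √(a ^ 2 + r ^ 2)) / (4 * Real.pi * √(a ^ 2 + r ^ 2)))]
  have hfin : Module.finrank ℝ (EuclideanSpace ℝ (Fin 2)) = 2 := by simp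
  have hvol : (volume : Measure (EuclideanSpace ℝ (Fin 2))).real (Metric.ball 0 1) = Real.pi := by
    rw [measureReal_def, EuclideanSpace.volume_ball_fin_two]
    simp [hp.le]
  rw [hfin, hvol]
  have h3 : ∫ r in Set.Ioi (0 : ℝ), r ^ (2 - 1) •
      (Real.exp (-μ * √(a ^ 2 + r ^ 2)) / (4 * Real.pi * √(a ^ 2 + r ^ 2)))
      = 0 - (-(Real.exp (-μ * √(a ^ 2 + 0 ^ 2)) / (4 * Real.pi * μ))) := by
    refine integral_Ioi_of_hasDerivAt_of_nonneg
      (g := fun r => -(Real.exp (-μ * √(a ^ 2 + r ^ 2)) / (4 * Real.pi * μ)))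
      (Continuous.continuousWithinAt (by fun_prop)) ?_ ?_ ?_
    · intro r hr
      have hr' : 0 < r := hr
      have hpos : 0 < a ^ 2 + r ^ 2 := by positivity
      have hs : 0 < √(a ^ 2 + r ^ 2) := Real.sqrt_pos.2 hpos
      have d1 : HasDerivAt (fun r : ℝ => a ^ 2 + r ^ 2) (2 * r) r := by
        simpa using (hasDerivAt_pow 2 r).const_add (a ^ 2)
      have d2 := (((d1.sqrt hpos.ne').const_mul (-μ)).exp.div_const (4 * Real.pi * μ)).neg
      refine d2.congr_deriv ?_
      rw [smul_eq_mul]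
      field_simp
      ring
    · intro r hr
      have hr' : 0 < r := hr
      rw [smul_eq_mul]
      positivity
    · have t1 : Filter.Tendsto (fun r : ℝ => μ * √(a ^ 2 + r ^ 2)) Filter.atTop Filter.atTop := by
        refine Filter.Tendsto.const_mul_atTop hμ ?_
        refine Filter.tendsto_atTop_mono (fun r => ?_) Filter.tendsto_id
        exact Real.le_sqrt_of_sq_le (by simp [sq_nonneg])
      have t2 := (Real.tendsto_exp_neg_atTop_nhds_zero.comp t1).div_const (4 * Real.pi * μ)
      have t3 := t2.neg
      simp only [zero_div, neg_zero] at t3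
      refine t3.congr fun r => ?_
      simp
  rw [h3]
  have h4 : √(a ^ 2 + 0 ^ 2) = |a| := by rw [zero_pow two_ne_zero, add_zero, Real.sqrt_sq_eq_abs]
  rw [h4]
  simp only [nsmul_eq_mul, smul_eq_mul]
  push_cast
  field_simp
  ring

theorem integral_cexp_mul_exp_abs {μ : ℝ} (hμ : 0 < μ) (ρ : ℝ) :
    ∫ a : ℝ, Complex.exp (((-2 * Real.pi * (a * ρ) : ℝ) : ℂ) * Complex.I)
      * ((Real.exp (-μ * |a|) / (2 * μ) : ℝ) : ℂ)
      = (((2 * Real.pi) ^ 2 * ρ ^ 2 + μ ^ 2 : ℝ) : ℂ)⁻¹ := by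
  set z : ℂ := ((2 * Real.pi * ρ : ℝ) : ℂ) * Complex.I with hz
  have hμc : (μ : ℂ) ≠ 0 := by exact_mod_cast hμ.ne'
  have e1 : ∀ a ∈ Set.Iic (0 : ℝ), Complex.exp (((-2 * Real.pi * (a * ρ) : ℝ) : ℂ) * Complex.I)
      * ((Real.exp (-μ * |a|) / (2 * μ) : ℝ) : ℂ)
      = (2 * μ : ℂ)⁻¹ * Complex.exp ((μ - z) * a) := by
    intro a ha
    rw [abs_of_nonpos ha]
    push_cast
    rw [mul_div_assoc', ← Complex.exp_add, div_eq_inv_mul, hz]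
    congr 2
    push_cast
    ring
  have e2 : ∀ a ∈ Set.Ioi (0 : ℝ), Complex.exp (((-2 * Real.pi * (a * ρ) : ℝ) : ℂ) * Complex.I)
      * ((Real.exp (-μ * |a|) / (2 * μ) : ℝ) : ℂ)
      = (2 * μ : ℂ)⁻¹ * Complex.exp ((-μ - z) * a) := by
    intro a ha
    rw [abs_of_pos ha]
    push_cast
    rw [mul_div_assoc', ← Complex.exp_add, div_eq_inv_mul, hz]
    congr 2
    push_cast
    ring
  have hz0 : z.re = 0 := by simp [hz]
  have r1 : 0 < ((μ : ℂ) - z).re := by simp [hz0, hμ]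
  have r2 : (-(μ : ℂ) - z).re < 0 := by simp [hz0, hμ]
  have i1 := ((integrableOn_exp_mul_complex_Iic r1 0).const_mul (2 * μ : ℂ)⁻¹)
  have i2 := ((integrableOn_exp_mul_complex_Ioi r2 0).const_mul (2 * μ : ℂ)⁻¹)
  rw [← intervalIntegral.integral_Iic_add_Ioi (b := 0)
    (IntegrableOn.congr_fun i1 (fun a ha => (e1 a ha).symm) measurableSet_Iic)
    (IntegrableOn.congr_fun i2 (fun a ha => (e2 a ha).symm) measurableSet_Ioi),
    setIntegral_congr_fun measurableSet_Iic e1, setIntegral_congr_fun measurableSet_Ioi e2,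
    integral_const_mul, integral_const_mul, integral_exp_mul_complex_Iic r1,
    integral_exp_mul_complex_Ioi r2]
  have n1 : (μ : ℂ) - z ≠ 0 := fun h => by rw [h] at r1; simp at r1
  have n2 : (μ : ℂ) + z ≠ 0 := fun h => by
    have : -(μ : ℂ) - z = 0 := by linear_combination -h
    rw [this] at r2; simp at r2
  have n3 : -(μ : ℂ) - z ≠ 0 := fun h => n2 (by linear_combination -h)
  have e3 : (((2 * Real.pi) ^ 2 * ρ ^ 2 + μ ^ 2 : ℝ) : ℂ) = (μ - z) * (μ + z) := by
    rw [hz]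
    push_cast
    linear_combination (2 * Real.pi * ρ : ℂ) ^ 2 * Complex.I_sq
  rw [e3]
  simp only [Complex.ofReal_zero, mul_zero, Complex.exp_zero]
  have e4 : -(1 : ℂ) / (-μ - z) = 1 / (μ + z) := by
    rw [div_eq_div_iff n3 n2]; ring
  rw [e4]
  field_simp
  ring

theorem fourier_greenFun {l : ℝ} (hl : 0 < l) (ξ : R3) :
    𝓕 (greenFun l) ξ = ((symb ξ + l : ℝ) : ℂ)⁻¹ := by
  set μ := Real.sqrt l with hμdef
  have hμ : 0 < μ := Real.sqrt_pos.2 hl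
  set w : R3 := EuclideanSpace.single 0 ‖ξ‖ with hw
  have hnorm : ‖ξ‖ = ‖w‖ := by simp [hw]
  -- A reflection moves `ξ` to the first coordinate axis.
  have hrot : 𝓕 (greenFun l) ξ = 𝓕 (greenFun l) w := by
    have h1 := Real.fourier_comp_linearIsometry
      ((Submodule.span ℝ {ξ - w})ᗮ.reflection) (greenFun l) ξ
    rw [Submodule.reflection_sub hnorm] at h1
    rw [← h1]
    have h2 : greenFun l ∘ (Submodule.span ℝ {ξ - w})ᗮ.reflection = greenFun l := by
      ext x
      simp [greenFun]
    rw [h2]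
  rw [hrot, Real.fourier_eq']
  set e : R3 ≃ᵐ ℝ × (Fin 2 → ℝ) := (MeasurableEquiv.toLp 2 (Fin 3 → ℝ)).symm.trans
    (MeasurableEquiv.piFinSuccAbove (fun _ => ℝ) 0) with he
  have hmp : MeasurePreserving e volume volume :=
    (EuclideanSpace.volume_preserving_symm_measurableEquiv_toLp (Fin 3)).trans
      (volume_preserving_piFinSuccAbove (fun _ => ℝ) 0)
  set h : ℝ × (Fin 2 → ℝ) → ℂ := fun p =>
    Complex.exp (((-2 * Real.pi * (p.1 * ‖ξ‖) : ℝ) : ℂ) * Complex.I) *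
      ((Real.exp (-μ * √(p.1 ^ 2 + ∑ i, p.2 i ^ 2)) /
        (4 * Real.pi * √(p.1 ^ 2 + ∑ i, p.2 i ^ 2)) : ℝ) : ℂ) with hh
  have hcomp : ∀ x : R3, Complex.exp (((-2 * Real.pi * inner ℝ x w : ℝ) : ℂ) * Complex.I) •
      greenFun l x = h (e x) := by
    intro x
    have h1 : (e x).1 = x 0 := rfl
    have h2 : √((e x).1 ^ 2 + ∑ i, (e x).2 i ^ 2) = ‖x‖ := by
      rw [EuclideanSpace.norm_eq]
      congr 1
      rw [Fin.sum_univ_succ]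
      simp only [Real.norm_eq_abs, sq_abs]
      rfl
    simp only [hh]
    rw [h2, h1, smul_eq_mul, greenFun, hw, EuclideanSpace.inner_single_right]
    simp [mul_comm, hμdef]
  simp_rw [hcomp]
  rw [hmp.integral_comp' h]
  have hint : Integrable h volume := by
    rw [← hmp.integrable_comp_emb e.measurableEmbedding]
    have h1 : Integrable (fun x : R3 => Complex.exp (((-2 * Real.pi * inner ℝ x w : ℝ) : ℂ)
        * Complex.I) • greenFun l x) volume := by
      refine (integrable_greenFun hl).mono ?_ (Filter.Eventually.of_forall fun x => ?_)
      · exact (Continuous.aestronglyMeasurable (f := fun x : R3 =>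
          Complex.exp (((-2 * Real.pi * inner ℝ x w : ℝ) : ℂ) * Complex.I)) (by fun_prop)).smul
          (integrable_greenFun hl).aestronglyMeasurable
      · rw [norm_smul, Complex.norm_exp_ofReal_mul_I, one_mul]
    exact h1.congr (Filter.Eventually.of_forall hcomp)
  rw [Measure.volume_eq_prod, integral_prod h (by rwa [← Measure.volume_eq_prod])]
  have hinner : ∀ a : ℝ, ∫ y : Fin 2 → ℝ, h (a, y)
      = Complex.exp (((-2 * Real.pi * (a * ‖ξ‖) : ℝ) : ℂ) * Complex.I)
        * ((Real.exp (-μ * |a|) / (2 * μ) : ℝ) : ℂ) := by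
    intro a
    simp only [hh]
    rw [integral_const_mul]
    congr 1
    rw [← integral_green_plane hμ a]
    exact integral_ofReal
  simp_rw [hinner]
  rw [integral_cexp_mul_exp_abs hμ, hμdef, Real.sq_sqrt hl.le, symb]

theorem coeFn_green {l : ℝ} (hl : 0 < l) : (green l hl : R3 → ℂ) =ᵐ[volume] greenFun l :=
  (memLp_greenFun hl).coeFn_toLp

theorem fourier_green {l : ℝ} (hl : 0 < l) :
    (𝓕 (green l hl) : L2) =ᵐ[volume] fun ξ => ((symb ξ + l : ℝ) : ℂ)⁻¹ := by
  refine (fourier_ae_eq_of_integrable ((integrable_greenFun hl).congr (coeFn_green hl).symm)).trans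
    (Filter.Eventually.of_forall fun ξ => ?_)
  change _ = ((symb ξ + l : ℝ) : ℂ)⁻¹
  rw [← fourier_greenFun hl]
  exact Real.fourier_congr_ae (coeFn_green hl) ξ

/-- The inner product of two Green functions. -/
theorem inner_green_green {l m : ℝ} (hl : 0 < l) (hm : 0 < m) :
    inner ℂ (green l hl) (green m hm) = ((4 * Real.pi * (√l + √m) : ℝ) : ℂ)⁻¹ := by
  have hp := Real.pi_pos
  have hsl : 0 < √l := Real.sqrt_pos.2 hl
  have hsm : 0 < √m := Real.sqrt_pos.2 hm
  rw [L2.inner_def]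
  have h1 : ∫ x, inner ℂ (green l hl x) (green m hm x) = ∫ x : R3, (((fun r : ℝ =>
      Real.exp (-√l * r) / (4 * Real.pi * r) * (Real.exp (-√m * r) / (4 * Real.pi * r))) ‖x‖
        : ℝ) : ℂ) := by
    refine integral_congr_ae ?_
    filter_upwards [coeFn_green hl, coeFn_green hm] with x h1 h2
    rw [h1, h2]
    simp only [greenFun, RCLike.inner_apply, Complex.conj_ofReal]
    push_cast
    ring
  rw [h1, show ∫ x : R3, (((fun r : ℝ =>
      Real.exp (-√l * r) / (4 * Real.pi * r) * (Real.exp (-√m * r) / (4 * Real.pi * r))) ‖x‖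
        : ℝ) : ℂ) = ((∫ x : R3, (fun r : ℝ =>
      Real.exp (-√l * r) / (4 * Real.pi * r) * (Real.exp (-√m * r) / (4 * Real.pi * r))) ‖x‖
        : ℝ) : ℂ) from integral_ofReal, integral_fun_norm_addHaar (volume : Measure R3) (fun r : ℝ =>
      Real.exp (-√l * r) / (4 * Real.pi * r) * (Real.exp (-√m * r) / (4 * Real.pi * r))),
    ← Complex.ofReal_inv]
  congr 1
  have hfin : Module.finrank ℝ R3 = 3 := by simp
  have hvol : (volume : Measure R3).real (Metric.ball 0 1) = Real.pi * 4 / 3 := by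
    rw [measureReal_def, EuclideanSpace.volume_ball_fin_three, ENNReal.ofReal_one, one_pow,
      one_mul, ENNReal.toReal_ofReal (by positivity)]
  rw [hfin, hvol]
  have h2 : ∫ r in Set.Ioi (0 : ℝ), r ^ (3 - 1) •
      (Real.exp (-√l * r) / (4 * Real.pi * r) * (Real.exp (-√m * r) / (4 * Real.pi * r)))
      = ∫ r in Set.Ioi (0 : ℝ), 1 / (16 * Real.pi ^ 2) * Real.exp (-(√l + √m) * r) := by
    refine setIntegral_congr_fun measurableSet_Ioi fun r hr => ?_
    have hr' : r ≠ 0 := ne_of_gt hr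
    have : Real.exp (-(√l + √m) * r) = Real.exp (-√l * r) * Real.exp (-√m * r) := by
      rw [← Real.exp_add]; congr 1; ring
    simp only [smul_eq_mul, this]
    field_simp
    ring
  rw [h2, integral_const_mul, integral_exp_mul_Ioi (by linarith)]
  simp only [nsmul_eq_mul, smul_eq_mul, mul_zero, Real.exp_zero]
  push_cast
  have : -(√l + √m) ≠ 0 := by linarith
  field_simp
  ring

theorem norm_green_sq {l : ℝ} (hl : 0 < l) : ‖green l hl‖ ^ 2 = (8 * Real.pi * √l)⁻¹ := by
  have h := inner_green_green hl hl
  rw [inner_self_eq_norm_sq_to_K] at h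
  have h1 : ((‖green l hl‖ : ℝ) : ℂ) ^ 2 = _ := h
  rw [show 8 * Real.pi * √l = 4 * Real.pi * (√l + √l) by ring]
  exact_mod_cast h1

/-- The resolvent of the Laplacian applied to a Green function. -/
theorem freeRes_green {l m : ℝ} (hl : 0 < l) (hm : 0 < m) :
    ((m - l : ℝ) : ℂ) • freeRes l hl (green m hm) = green l hl - green m hm := by
  refine eq_of_fourier_ae_eq ?_
  rw [fourier_sub, FourierTransform.fourier_smul]
  filter_upwards [fourier_green hl, fourier_green hm, fourier_freeRes hl (green m hm),
    Lp.coeFn_sub (𝓕 (green l hl) : L2) (𝓕 (green m hm)),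
    Lp.coeFn_smul ((m - l : ℝ) : ℂ) (𝓕 (freeRes l hl (green m hm)) : L2)] with ξ h1 h2 h3 h4 h5
  rw [h5, h4, Pi.smul_apply, Pi.sub_apply, h1, h3, h2, smul_eq_mul]
  have a1 := symb_add_ne hl ξ
  have a2 := symb_add_ne hm ξ
  push_cast at a1 a2 ⊢
  field_simp
  ring

theorem inner_green {l : ℝ} (hl : 0 < l) (g : L2) :
    inner ℂ (green l hl) g = ∫ ξ, ((symb ξ + l : ℝ) : ℂ)⁻¹ * (𝓕 g : L2) ξ := by
  rw [← Lp.inner_fourier_eq, L2.inner_def]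
  refine integral_congr_ae ?_
  filter_upwards [fourier_green hl] with ξ h
  rw [h, RCLike.inner_apply, map_inv₀, Complex.conj_ofReal, mul_comm]

/-- Functions `(-Δ + l)⁻¹ w` are continuous, and their value at the origin is the integral of `w`
against the Green function. -/
theorem hasValueAtZero_freeRes {l : ℝ} (hl : 0 < l) (w : L2) :
    HasValueAtZero (freeRes l hl w) (inner ℂ (green l hl) w) := by
  have h1 : Integrable ((𝓕 (freeRes l hl w) : L2) : R3 → ℂ) := by
    refine (MemLp.integrable_mul (Lp.memLp (𝓕 (green l hl) : L2))
      (Lp.memLp (𝓕 w : L2))).congr ?_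
    filter_upwards [fourier_green hl, fourier_freeRes hl w] with ξ h2 h3
    rw [h3, Pi.mul_apply, h2]
  rw [inner_green, ← integral_congr_ae (fourier_freeRes hl w)]
  exact hasValueAtZero_of_integrable_fourier h1

/-! ### The resolvent of the point interaction -/

/-- The number `α + √l / 4π`. -/
def strength (α l : ℝ) : ℝ := α + √l / (4 * Real.pi)

theorem strength_pos {α l : ℝ} (hα : 0 ≤ α) (hl : 0 < l) : 0 < strength α l := by
  have := Real.sqrt_pos.2 hl
  have := Real.pi_pos
  unfold strength
  positivity

theorem strength_ne {α l : ℝ} (hα : 0 ≤ α) (hl : 0 < l) : (strength α l : ℂ) ≠ 0 := by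
  exact_mod_cast (strength_pos hα hl).ne'

/-- Krein's formula for the resolvent `(-Δ_α + l)⁻¹`: the free resolvent plus a rank one term. -/
def pointRes (α l : ℝ) (hl : 0 < l) : L2 →ₗ[ℂ] L2 where
  toFun g := freeRes l hl g + (inner ℂ (green l hl) g / (strength α l : ℂ)) • green l hl
  map_add' g g' := by
    rw [map_add, inner_add_right, add_div, add_smul]
    abel
  map_smul' c g := by
    rw [map_smul, inner_smul_right, mul_div_assoc, mul_smul, RingHom.id_apply, smul_add]

theorem pointRes_apply (α : ℝ) {l : ℝ} (hl : 0 < l) (g : L2) : pointRes α l hl g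
    = freeRes l hl g + (inner ℂ (green l hl) g / (strength α l : ℂ)) • green l hl := rfl

theorem mem_hamiltonianGraph_iff (α : ℝ) {l : ℝ} (hl : 0 < l) (u h : L2) :
    (u, h) ∈ hamiltonianGraph α l hl ↔ u = pointRes α l hl (h + (l : ℂ) • u) := by
  constructor
  · rintro ⟨f, hf, v, hv, hu, hh⟩
    have h1 := (mem_sobolev_two_and_eq_iff hl).1 ⟨hf, hh⟩
    simp only at h1 hu
    rw [h1] at hv
    rw [pointRes_apply, ← h1, ← hv.unique (hasValueAtZero_freeRes hl _)]
    exact hu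
  · intro hu
    obtain ⟨hf, hh⟩ := (mem_sobolev_two_and_eq_iff hl).2
      (rfl : freeRes l hl (h + (l : ℂ) • u) = _)
    exact ⟨_, hf, _, hasValueAtZero_freeRes hl _, hu, hh⟩

theorem inner_pointRes_left (α : ℝ) {l : ℝ} (hl : 0 < l) (f g : L2) :
    inner ℂ (pointRes α l hl f) g = inner ℂ f (pointRes α l hl g) := by
  rw [pointRes_apply, pointRes_apply, inner_add_left, inner_add_right, inner_freeRes_left,
    inner_smul_left, inner_smul_right, map_div₀, Complex.conj_ofReal, inner_conj_symm]
  ring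

theorem re_inner_pointRes_nonneg {α l : ℝ} (hα : 0 ≤ α) (hl : 0 < l) (g : L2) :
    0 ≤ (inner ℂ g (pointRes α l hl g)).re := by
  have h1 := re_inner_freeRes_nonneg hl g
  have hs := strength_pos hα hl
  have h2 : inner ℂ (green l hl) g / (strength α l : ℂ) * inner ℂ g (green l hl)
      = ((‖(inner ℂ g (green l hl) : ℂ)‖ ^ 2 / strength α l : ℝ) : ℂ) := by
    rw [← inner_conj_symm (green l hl) g, div_mul_eq_mul_div, Complex.conj_mul']
    push_cast
    rfl
  rw [pointRes_apply, inner_add_right, inner_smul_right, h2, Complex.add_re, Complex.ofReal_re]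
  positivity

/-- The first resolvent identity.  The rank one terms match because
`(m - l) ⟪G_l, G_m⟫ = (√m - √l) / 4π`. -/
theorem pointRes_pointRes {α l m : ℝ} (hα : 0 ≤ α) (hl : 0 < l) (hm : 0 < m) (g : L2) :
    ((m - l : ℝ) : ℂ) • pointRes α l hl (pointRes α m hm g)
      = pointRes α l hl g - pointRes α m hm g := by
  have hsl := strength_ne hα hl
  have hsm := strength_ne hα hm
  have e1 := freeRes_freeRes hl hm g
  have e2 := freeRes_green hl hm
  have e3 : ((m - l : ℝ) : ℂ) * inner ℂ (green l hl) (freeRes m hm g)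
      = inner ℂ (green l hl) g - inner ℂ (green m hm) g := by
    have h1 := congrArg (fun x : L2 => inner ℂ x g) (freeRes_green hm hl)
    simp only [inner_smul_left, inner_sub_left, inner_freeRes_left, Complex.conj_ofReal] at h1
    push_cast at h1 ⊢
    linear_combination -h1
  have e4 : ((m - l : ℝ) : ℂ) * inner ℂ (green l hl) (green m hm)
      = strength α m - strength α l := by
    rw [inner_green_green, ← Complex.ofReal_inv, ← Complex.ofReal_mul, ← Complex.ofReal_sub]
    congr 1
    have h1 := Real.sqrt_pos.2 hl
    have h2 := Real.sqrt_pos.2 hm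
    have h3 := Real.sq_sqrt hl.le
    have h4 := Real.sq_sqrt hm.le
    have hp := Real.pi_pos
    unfold strength
    field_simp
    linear_combination h3 - h4
  simp only [pointRes_apply, map_add, map_smul, smul_add, smul_smul]
  rw [e1, mul_comm ((m - l : ℝ) : ℂ) (inner ℂ (green m hm) g / _), ← smul_smul _ ((m - l : ℝ) : ℂ),
    e2]
  have e5 : ((m - l : ℝ) : ℂ) * ((inner ℂ (green l hl) (freeRes m hm g)
        + inner ℂ (green m hm) g / (strength α m : ℂ) * inner ℂ (green l hl) (green m hm))
          / (strength α l : ℂ))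
      = inner ℂ (green l hl) g / (strength α l : ℂ)
        - inner ℂ (green m hm) g / (strength α m : ℂ) := by
    field_simp
    linear_combination (strength α m : ℂ) * e3 + inner ℂ (green m hm) g * e4
  linear_combination (norm := module) e5 • green l hl

/-- The operator does not depend on the reference value. -/
theorem eq_pointRes_of_eq_pointRes {α l m : ℝ} (hα : 0 ≤ α) (hl : 0 < l) (hm : 0 < m) {u h : L2}
    (hu : u = pointRes α m hm (h + (m : ℂ) • u)) : u = pointRes α l hl (h + (l : ℂ) • u) := by
  have h1 := pointRes_pointRes hα hl hm (h + (m : ℂ) • u)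
  rw [← hu] at h1
  have h2 : h + (l : ℂ) • u = (h + (m : ℂ) • u) - ((m - l : ℝ) : ℂ) • u := by
    push_cast; module
  rw [h2, map_sub, map_smul, h1]
  abel

theorem coe_eq_pointRes {α l₀ l : ℝ} (hα : 0 ≤ α) (hl₀ : 0 < l₀) (hl : 0 < l)
    (u : (hamiltonian α l₀ hl₀).domain) :
    (u : L2) = pointRes α l hl (hamiltonian α l₀ hl₀ u + (l : ℂ) • (u : L2)) := by
  have h1 := (hamiltonian α l₀ hl₀).mem_graph u
  rw [graph_hamiltonian, mem_hamiltonianGraph_iff] at h1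
  exact eq_pointRes_of_eq_pointRes hα hl hl₀ h1

theorem exists_hamiltonian_resolvent {α l₀ l : ℝ} (hα : 0 ≤ α) (hl₀ : 0 < l₀) (hl : 0 < l)
    (g : L2) : ∃ u : (hamiltonian α l₀ hl₀).domain, (u : L2) = pointRes α l hl g ∧
      hamiltonian α l₀ hl₀ u = g - (l : ℂ) • pointRes α l hl g := by
  have h1 : (pointRes α l hl g, g - (l : ℂ) • pointRes α l hl g)
      ∈ (hamiltonian α l₀ hl₀).graph := by
    rw [graph_hamiltonian, mem_hamiltonianGraph_iff]
    refine eq_pointRes_of_eq_pointRes hα hl₀ hl ?_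
    rw [sub_add_cancel]
  obtain ⟨u, hu, hu'⟩ := (LinearPMap.mem_graph_iff _).1 h1
  exact ⟨u, hu, hu'⟩

theorem isNonnegSelfAdjoint_hamiltonian {α l₀ : ℝ} (hα : 0 ≤ α) (hl₀ : 0 < l₀) :
    IsNonnegSelfAdjoint (hamiltonian α l₀ hl₀) where
  symm u v := by
    have hu := coe_eq_pointRes hα hl₀ one_pos u
    have hv := coe_eq_pointRes hα hl₀ one_pos v
    have h1 := inner_pointRes_left α one_pos
      (hamiltonian α l₀ hl₀ u + ((1 : ℝ) : ℂ) • (u : L2))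
      (hamiltonian α l₀ hl₀ v + ((1 : ℝ) : ℂ) • (v : L2))
    rw [← hu, ← hv, Complex.ofReal_one, one_smul, one_smul, inner_add_left, inner_add_right] at h1
    exact (add_right_cancel h1).symm
  nonneg u := by
    have h1 : ∀ l : ℝ, 0 < l →
        0 ≤ (inner ℂ (u : L2) (hamiltonian α l₀ hl₀ u)).re + l * ‖(u : L2)‖ ^ 2 := by
      intro l hl
      have h2 := re_inner_pointRes_nonneg hα hl (hamiltonian α l₀ hl₀ u + (l : ℂ) • (u : L2))
      rw [← coe_eq_pointRes hα hl₀ hl u, inner_add_left, inner_smul_left, Complex.conj_ofReal,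
        inner_self_eq_norm_sq_to_K, ← inner_conj_symm] at h2
      have h3 : ((l : ℂ) * ((‖(u : L2)‖ : ℝ) : ℂ) ^ 2).re = l * ‖(u : L2)‖ ^ 2 := by norm_cast
      rw [Complex.add_re, Complex.conj_re] at h2
      exact h2.trans_eq (congrArg _ h3)
    by_contra hneg
    push Not at hneg
    set x := (inner ℂ (u : L2) (hamiltonian α l₀ hl₀ u)).re
    have h4 := h1 (-x / (‖(u : L2)‖ ^ 2 + 1)) (by
      have : 0 < -x := by linarith
      positivity)
    have h5 : x + -x / (‖(u : L2)‖ ^ 2 + 1) * ‖(u : L2)‖ ^ 2 = x / (‖(u : L2)‖ ^ 2 + 1) := by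
      field_simp
      ring
    rw [h5] at h4
    have : x / (‖(u : L2)‖ ^ 2 + 1) < 0 := div_neg_of_neg_of_pos hneg (by positivity)
    linarith
  surj g := by
    obtain ⟨u, hu, hu'⟩ := exists_hamiltonian_resolvent hα hl₀ one_pos g
    exact ⟨u, by rw [hu, hu', Complex.ofReal_one, one_smul, sub_add_cancel]⟩

theorem four_pow_pos (n : ℕ) : (0 : ℝ) < 4 ^ n := by positivity

/-- The Green function at the energy `-4^n`. -/
abbrev dyadicGreen (n : ℕ) : L2 := green (4 ^ n) (four_pow_pos n)

/-- The free resolvent at the energy `-4^n`. -/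
abbrev dyadicRes (n : ℕ) : L2 →ₗ[ℂ] L2 := freeRes (4 ^ n) (four_pow_pos n)

/-- The vector `-Δ (-Δ + 4^n)⁻¹ f`. -/
def freeDefect (f : L2) (n : ℕ) : L2 := f - ((4 ^ n : ℝ) : ℂ) • dyadicRes n f

/-- The number `4^n ⟪G_{4^n}, f⟫`, which tends to `f(0)` for regular `f`. -/
def approxValue (f : L2) (n : ℕ) : ℂ := ((4 ^ n : ℝ) : ℂ) * inner ℂ (dyadicGreen n) f

/-- The coefficient of `G_{4^n}` in `4^n (-Δ_α + 4^n)⁻¹ g`. -/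
def charge (α : ℝ) (g : L2) (n : ℕ) : ℂ := approxValue g n / (strength α (4 ^ n) : ℂ)

/-- The vector `-Δ_α (-Δ_α + 4^n)⁻¹ g = g - 4^n (-Δ_α + 4^n)⁻¹ g`, written out by
Krein's formula. -/
def pointDefect (α : ℝ) (g : L2) (n : ℕ) : L2 := freeDefect g n - charge α g n • dyadicGreen n

/-- The domain of the fractional powers of `-Δ_α` in terms of its resolvents. -/
theorem mem_powerDomain_hamiltonian_iff {α l₀ s : ℝ} (hα : 0 ≤ α) (hl₀ : 0 < l₀) (hs0 : 0 < s)
    (hs2 : s < 2) (g : L2) :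
    g ∈ powerDomain (hamiltonian α l₀ hl₀) (s / 2) ↔
      Summable fun n => ((2 ^ s : ℝ) ^ n * ‖pointDefect α g n‖) ^ 2 := by
  choose u hu hu' using fun n : ℕ => exists_hamiltonian_resolvent hα hl₀ (four_pow_pos n) g
  rw [mem_powerDomain_iff_summable (isNonnegSelfAdjoint_hamiltonian hα hl₀) hs0 hs2 (u := u)
    (fun n => by rw [hu, hu', sub_add_cancel])]
  have : ∀ n, hamiltonian α l₀ hl₀ (u n) = pointDefect α g n := by
    intro n
    rw [hu', pointRes_apply, pointDefect, freeDefect, charge, approxValue, smul_add, smul_smul,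
      mul_div_assoc, sub_sub]
  simp_rw [this]

/-! ### Dyadic estimates -/

/-- The number `2^{-1/2}`. -/
def invSqrtTwo : ℝ := (√2)⁻¹

theorem invSqrtTwo_pos : 0 < invSqrtTwo := by unfold invSqrtTwo; positivity

theorem invSqrtTwo_sq : invSqrtTwo ^ 2 = 1 / 2 := by
  rw [invSqrtTwo, inv_pow, Real.sq_sqrt (by norm_num)]; norm_num

theorem invSqrtTwo_eq_rpow : invSqrtTwo = (2 : ℝ) ^ (-(1 / 2) : ℝ) := by
  rw [Real.rpow_neg (by norm_num), ← Real.sqrt_eq_rpow, invSqrtTwo]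

theorem rpow_mul_invSqrtTwo (s : ℝ) : (2 : ℝ) ^ s * invSqrtTwo = 2 ^ (s - 1 / 2) := by
  rw [invSqrtTwo_eq_rpow, ← Real.rpow_add (by norm_num), sub_eq_add_neg]

theorem rpow_mul_invSqrtTwo_pow_three (s : ℝ) :
    (2 : ℝ) ^ s * invSqrtTwo ^ 3 = 2 ^ (s - 3 / 2) := by
  rw [invSqrtTwo_eq_rpow, ← Real.rpow_mul_natCast (by norm_num), ← Real.rpow_add (by norm_num)]
  congr 1
  push_cast
  ring

theorem rpow_mul_invSqrtTwo_pow_five_lt {s : ℝ} (hs : s < 2) :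
    (2 : ℝ) ^ s * invSqrtTwo ^ 5 < 1 := by
  rw [invSqrtTwo_eq_rpow, ← Real.rpow_mul_natCast (by norm_num), ← Real.rpow_add (by norm_num)]
  refine Real.rpow_lt_one_of_one_lt_of_neg (by norm_num) ?_
  push_cast
  linarith

theorem rpow_div_four_lt {s : ℝ} (hs : s < 2) : (2 : ℝ) ^ s / 4 < 1 := by
  rw [div_lt_one (by norm_num)]
  calc (2 : ℝ) ^ s < 2 ^ (2 : ℝ) := Real.rpow_lt_rpow_of_exponent_lt (by norm_num) hs
    _ = 4 := by norm_num

theorem sqrt_four_pow (n : ℕ) : √((4 : ℝ) ^ n) = 2 ^ n := by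
  rw [show (4 : ℝ) ^ n = (2 ^ n) ^ 2 by rw [← pow_mul, mul_comm, pow_mul]; norm_num]
  exact Real.sqrt_sq (by positivity)

/-- The norm of `G_1`. -/
def greenNorm : ℝ := (√(8 * Real.pi))⁻¹

theorem greenNorm_pos : 0 < greenNorm := by
  have := Real.pi_pos
  unfold greenNorm; positivity

theorem norm_dyadicGreen (n : ℕ) : ‖dyadicGreen n‖ = greenNorm * invSqrtTwo ^ n := by
  have h1 := invSqrtTwo_pos
  have h2 := greenNorm_pos
  have hp := Real.pi_pos
  refine (sq_eq_sq₀ (norm_nonneg _) (by positivity)).1 ?_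
  rw [norm_green_sq, sqrt_four_pow, mul_pow, ← pow_mul, mul_comm n 2, pow_mul, invSqrtTwo_sq,
    greenNorm, inv_pow, Real.sq_sqrt (by positivity), mul_inv, one_div, inv_pow]

theorem strength_four_pow (α : ℝ) (n : ℕ) :
    strength α (4 ^ n) = α + 2 ^ n / (4 * Real.pi) := by
  rw [strength, sqrt_four_pow]

theorem inv_strength_le {α : ℝ} (hα : 0 ≤ α) (n : ℕ) :
    (strength α (4 ^ n))⁻¹ ≤ 4 * Real.pi * (2 ^ n)⁻¹ := by
  have hp := Real.pi_pos
  rw [strength_four_pow, inv_le_comm₀ (by positivity) (by positivity), mul_inv, inv_inv]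
  rw [div_eq_inv_mul]
  linarith

theorem strength_four_pow_le {α : ℝ} (hα : 0 ≤ α) (n : ℕ) :
    strength α (4 ^ n) ≤ (α + 1) * 2 ^ n := by
  have hp := Real.pi_gt_three
  have h1 : (1 : ℝ) ≤ 2 ^ n := one_le_pow₀ (by norm_num)
  rw [strength_four_pow, add_mul, one_mul]
  refine add_le_add (le_mul_of_one_le_right hα h1) (div_le_self (by positivity) (by linarith))

theorem norm_dyadicRes_green_le {l : ℝ} (hl : 0 < l) (n : ℕ) :
    ‖dyadicRes n (green l hl)‖ ≤ ‖green l hl‖ * (4 ^ n)⁻¹ := by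
  rw [← div_eq_mul_inv, le_div_iff₀ (four_pow_pos n), mul_comm]
  exact mul_norm_freeRes_le _ _

theorem freeDefect_green {l : ℝ} (hl : 0 < l) (n : ℕ) :
    freeDefect (green l hl) n = dyadicGreen n - (l : ℂ) • dyadicRes n (green l hl) := by
  have h := freeRes_green (four_pow_pos n) hl
  rw [freeDefect, dyadicGreen]
  push_cast at h ⊢
  linear_combination (norm := module) h

theorem freeDefect_add_smul (f g : L2) (c : ℂ) (n : ℕ) :
    freeDefect (f + c • g) n = freeDefect f n + c • freeDefect g n := by
  simp only [freeDefect, map_add, map_smul]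
  module

theorem summable_shift {x : ℕ → ℝ} (h : Summable fun n => x n ^ 2) :
    Summable fun n => x (n + 1) ^ 2 :=
  (summable_nat_add_iff (f := fun n => x n ^ 2) 1).2 h

/-- The increments of the charges are controlled by the vectors `-Δ_α (-Δ_α + 4^n)⁻¹ g`, because
`(-Δ + 4^n) (-Δ + 4^{n+1})⁻¹` is a contraction. -/
theorem norm_charge_sub_mul_le (α : ℝ) (g : L2) (n : ℕ) :
    ‖charge α g (n + 1) - charge α g n‖ * ‖dyadicGreen (n + 1)‖
      ≤ ‖pointDefect α g n‖ + ‖pointDefect α g (n + 1)‖ := by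
  have h4 : (4 : ℝ) ^ n ≤ 4 ^ (n + 1) := pow_le_pow_right₀ (by norm_num) (Nat.le_succ n)
  have h1 := norm_sub_smul_freeRes_le (m := 4 ^ (n + 1) - 4 ^ n) (four_pow_pos (n + 1))
    (by linarith) (by have := four_pow_pos n; linarith) (pointDefect α g n)
  have e1 := freeRes_freeRes (four_pow_pos (n + 1)) (four_pow_pos n) g
  have e2 := freeRes_green (four_pow_pos (n + 1)) (four_pow_pos n)
  have h2 : pointDefect α g n
      - ((4 ^ (n + 1) - 4 ^ n : ℝ) : ℂ) • dyadicRes (n + 1) (pointDefect α g n)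
      = pointDefect α g (n + 1)
        + (charge α g (n + 1) - charge α g n) • dyadicGreen (n + 1) := by
    simp only [pointDefect, freeDefect, map_sub, map_smul]
    push_cast at e1 e2 ⊢
    linear_combination (norm := module) (-(4 : ℂ) ^ n) • e1 - (charge α g n) • e2
  rw [h2] at h1
  calc ‖charge α g (n + 1) - charge α g n‖ * ‖dyadicGreen (n + 1)‖
      = ‖(pointDefect α g (n + 1)
        + (charge α g (n + 1) - charge α g n) • dyadicGreen (n + 1)) - pointDefect α g (n + 1)‖ := by
        rw [add_sub_cancel_left, norm_smul]
    _ ≤ _ := (norm_sub_le _ _).trans (by gcongr)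

/-- The increments of `4^n ⟪G_{4^n}, f⟫` are controlled by the vectors `-Δ (-Δ + 4^n)⁻¹ f`. -/
theorem norm_approxValue_sub_le (f : L2) (n : ℕ) :
    ‖approxValue f (n + 1) - approxValue f n‖
      ≤ 3 * 4 ^ n * (‖dyadicGreen (n + 1)‖ * ‖freeDefect f n‖) := by
  have e1 := congrArg (fun x : L2 => inner ℂ x f)
    (freeRes_green (four_pow_pos n) (four_pow_pos (n + 1)))
  simp only [inner_smul_left, inner_sub_left, inner_freeRes_left, Complex.conj_ofReal] at e1
  have h1 : approxValue f (n + 1) - approxValue f n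
      = ((3 * 4 ^ n : ℝ) : ℂ) * inner ℂ (dyadicGreen (n + 1)) (freeDefect f n) := by
    rw [freeDefect, inner_sub_right, inner_smul_right, approxValue, approxValue]
    push_cast at e1 ⊢
    rw [pow_succ] at e1 ⊢
    linear_combination (4 : ℂ) ^ n * e1
  rw [h1, norm_mul, Complex.norm_real, Real.norm_of_nonneg (by positivity)]
  gcongr
  exact norm_inner_le_norm _ _

/-- The defect of `f + k G_l` in terms of the defect of `f`. -/
theorem pointDefect_add_smul_green (α : ℝ) {l : ℝ} (hl : 0 < l) (f : L2) (k : ℂ) (n : ℕ) :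
    pointDefect α (f + k • green l hl) n = freeDefect f n
      + (k - charge α (f + k • green l hl) n) • dyadicGreen n
      - (k * l) • dyadicRes n (green l hl) := by
  rw [pointDefect, freeDefect_add_smul, freeDefect_green]
  module

/-- The distance of `k` from the charge of `f + k G_l`. Up to a factor of order `2^{-n}`, it is the
distance of `4^n ⟪G_{4^n}, f⟫` from `k (α + √l / 4π)`. -/
theorem sub_charge_add_smul_green {α l : ℝ} (hα : 0 ≤ α) (hl : 0 < l) (f : L2) (k : ℂ) (n : ℕ) :
    k - charge α (f + k • green l hl) n
      = (k * strength α l - approxValue f n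
          - k * ((l / (4 * Real.pi * (√l + 2 ^ n)) : ℝ) : ℂ)) / (strength α (4 ^ n) : ℂ) := by
  have hs := strength_ne hα (four_pow_pos n)
  have hsl := Real.sqrt_pos.2 hl
  have h2 : (0 : ℝ) < 2 ^ n := by positivity
  have hp := Real.pi_pos
  have h1 : strength α (4 ^ n) - 4 ^ n * (4 * Real.pi * (2 ^ n + √l))⁻¹
      = strength α l - l / (4 * Real.pi * (√l + 2 ^ n)) := by
    have h3 := Real.sq_sqrt hl.le
    have h4 : (4 : ℝ) ^ n = (2 ^ n) ^ 2 := by rw [← pow_mul, mul_comm, pow_mul]; norm_num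
    have key : ∀ x a : ℝ, 0 < x → 0 < a → α + a / (4 * Real.pi) - a ^ 2 * (4 * Real.pi * (a + x))⁻¹
        = α + x / (4 * Real.pi) - x ^ 2 / (4 * Real.pi * (x + a)) := by
      intro x a hx ha
      field_simp
      ring
    have h5 := key _ _ hsl h2
    rwa [h3, ← h4, ← strength_four_pow] at h5
  have h3 := congrArg (fun x : ℝ => (x : ℂ)) h1
  rw [eq_div_iff hs, charge, sub_mul, div_mul_cancel₀ _ hs, approxValue, approxValue,
    inner_add_right, inner_smul_right, inner_green_green, sqrt_four_pow]
  push_cast at h3 ⊢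
  linear_combination k * h3

section Sobolev

variable {α l s : ℝ}

theorem one_le_two_rpow (hs : 0 < s) : 1 ≤ (2 : ℝ) ^ s := Real.one_le_rpow (by norm_num) hs.le

theorem rpow_mul_invSqrtTwo_pow_three_pow (s : ℝ) (n : ℕ) : ((2 : ℝ) ^ s * invSqrtTwo ^ 3) ^ n
    = (2 ^ s) ^ n * (2 ^ n)⁻¹ * invSqrtTwo ^ n := by
  rw [mul_pow, pow_succ, mul_pow, invSqrtTwo_sq, one_div, inv_pow]
  ring

/-- For `f ∈ H^s`, the increments of `4^n ⟪G_{4^n}, f⟫` are square summable with weights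
`2^{n(s - 3/2)}`. -/
theorem summable_approxValue_sub (hs0 : 0 < s) (hs2 : s < 2) {f : L2} (hf : f ∈ sobolev s) :
    Summable fun n => (((2 : ℝ) ^ s * invSqrtTwo ^ 3) ^ n *
      ‖approxValue f (n + 1) - approxValue f n‖) ^ 2 := by
  have hω := invSqrtTwo_pos
  have hg := greenNorm_pos
  refine summable_sq_of_le (3 * greenNorm * invSqrtTwo) (fun n => by positivity) (fun n => ?_)
    ((mem_sobolev_iff_summable hs0 hs2).1 hf)
  refine (mul_le_mul_of_nonneg_left (norm_approxValue_sub_le f n) (by positivity)).trans_eq ?_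
  have h2 : (2 : ℝ) ^ n ≠ 0 := by positivity
  have h4 : (4 : ℝ) ^ n = 2 ^ n * 2 ^ n := by rw [← mul_pow]; norm_num
  have hω2 : invSqrtTwo ^ n * invSqrtTwo ^ n = (2 ^ n)⁻¹ := by
    rw [← mul_pow, ← sq, invSqrtTwo_sq, one_div, inv_pow]
  change _ = 3 * greenNorm * invSqrtTwo * ((2 ^ s) ^ n * ‖freeDefect f n‖)
  generalize ‖freeDefect f n‖ = d
  rw [norm_dyadicGreen, rpow_mul_invSqrtTwo_pow_three_pow, h4, pow_succ invSqrtTwo n]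
  calc _ = 3 * greenNorm * invSqrtTwo * ((2 ^ s) ^ n * d)
        * ((2 ^ n)⁻¹ * 2 ^ n) * (2 ^ n * (invSqrtTwo ^ n * invSqrtTwo ^ n)) := by ring
    _ = _ := by rw [hω2, inv_mul_cancel₀ h2, mul_inv_cancel₀ h2]; ring

theorem summable_green_correction (hs2 : s < 2) (C : ℝ) :
    Summable fun n : ℕ => ((2 ^ s : ℝ) ^ n * (C * (4 ^ n)⁻¹)) ^ 2 := by
  refine (summable_sq_geometric C (ρ := 2 ^ s / 4) (by positivity)
    (rpow_div_four_lt hs2)).congr fun n => ?_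
  rw [div_pow, div_eq_mul_inv]
  ring

/-- For `f ∈ H^s`, the vector `f + k G_l` lies in the domain of `(-Δ_α)^{s/2}` as soon as
`4^n ⟪G_{4^n}, f⟫` is close to `k (α + √l / 4π)`. -/
theorem summable_pointDefect_of_summable (hα : 0 ≤ α) (hl : 0 < l) (hs0 : 0 < s) (hs2 : s < 2)
    {f : L2} (hf : f ∈ sobolev s) {k : ℂ}
    (h : Summable fun n => (((2 : ℝ) ^ s * invSqrtTwo ^ 3) ^ n *
      ‖k * strength α l - approxValue f n‖) ^ 2) :
    Summable fun n => ((2 ^ s : ℝ) ^ n * ‖pointDefect α (f + k • green l hl) n‖) ^ 2 := by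
  have hω := invSqrtTwo_pos
  have hg := greenNorm_pos
  have hp := Real.pi_pos
  have hsl := Real.sqrt_pos.2 hl
  have hf' := (mem_sobolev_iff_summable hs0 hs2).1 hf
  -- The coefficient of `G_{4^n}` in the defect.
  have h1 : Summable fun n => ((2 ^ s : ℝ) ^ n *
      (‖k - charge α (f + k • green l hl) n‖ * ‖dyadicGreen n‖)) ^ 2 := by
    refine summable_sq_of_le_add (4 * Real.pi * greenNorm) (fun n => by positivity) (fun n => ?_) h
      (summable_sq_geometric (‖k‖ * (l / (4 * Real.pi))) (ρ := 2 ^ s * invSqrtTwo ^ 5)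
        (by positivity) (rpow_mul_invSqrtTwo_pow_five_lt hs2))
    have hspos := strength_pos hα (four_pow_pos n)
    have h5 : ((2 : ℝ) ^ s * invSqrtTwo ^ 5) ^ n
        = ((2 : ℝ) ^ s * invSqrtTwo ^ 3) ^ n * (2 ^ n)⁻¹ := by
      rw [show invSqrtTwo ^ 5 = invSqrtTwo ^ 3 * invSqrtTwo ^ 2 by ring, invSqrtTwo_sq,
        ← mul_assoc, mul_pow, one_div, inv_pow]
    have h6 : l / (4 * Real.pi * (√l + 2 ^ n)) ≤ l / (4 * Real.pi) * (2 ^ n)⁻¹ := by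
      rw [← div_eq_mul_inv, div_div]
      gcongr
      linarith
    have h7 : ‖k - charge α (f + k • green l hl) n‖
        ≤ (‖k * strength α l - approxValue f n‖ + ‖k‖ * (l / (4 * Real.pi) * (2 ^ n)⁻¹))
          * (4 * Real.pi * (2 ^ n)⁻¹) := by
      rw [sub_charge_add_smul_green hα hl, norm_div, Complex.norm_real,
        Real.norm_of_nonneg hspos.le, div_eq_mul_inv]
      refine mul_le_mul ?_ (inv_strength_le hα n) (by positivity) (by positivity)
      refine (norm_sub_le _ _).trans ?_
      rw [norm_mul k ((_ : ℝ) : ℂ), Complex.norm_real, Real.norm_of_nonneg (by positivity)]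
      gcongr
    rw [norm_dyadicGreen, h5, rpow_mul_invSqrtTwo_pow_three_pow]
    calc _ ≤ (2 ^ s : ℝ) ^ n * (((‖k * strength α l - approxValue f n‖
          + ‖k‖ * (l / (4 * Real.pi) * (2 ^ n)⁻¹)) * (4 * Real.pi * (2 ^ n)⁻¹))
            * (greenNorm * invSqrtTwo ^ n)) := by gcongr
      _ = _ := by ring
  have h2 := summable_green_correction hs2 (‖k * l‖ * ‖green l hl‖)
  refine summable_sq_of_le_add (x := fun n => (2 ^ s : ℝ) ^ n * ‖freeDefect f n‖
      + (2 ^ s : ℝ) ^ n * (‖k - charge α (f + k • green l hl) n‖ * ‖dyadicGreen n‖))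
    1 (fun n => by positivity) (fun n => ?_)
    (summable_sq_of_le_add 1 (fun n => by positivity) (fun n => by rw [one_mul]; exact le_rfl)
        hf' h1) h2
  rw [pointDefect_add_smul_green, one_mul, ← mul_add, ← mul_add]
  gcongr
  refine (norm_sub_le _ _).trans ?_
  gcongr
  · refine (norm_add_le _ _).trans ?_
    rw [norm_smul]
  · rw [norm_smul, mul_assoc]
    gcongr
    exact norm_dyadicRes_green_le hl n

/-- Conversely, if `f ∈ H^s` and `f + k G_l` lies in the domain of `(-Δ_α)^{s/2}`, then
`4^n ⟪G_{4^n}, f⟫` is close to `k (α + √l / 4π)`. -/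
theorem summable_of_summable_pointDefect (hα : 0 ≤ α) (hl : 0 < l) (hs0 : 0 < s) (hs2 : s < 2)
    {f : L2} (hf : f ∈ sobolev s) {k : ℂ}
    (h : Summable fun n => ((2 ^ s : ℝ) ^ n * ‖pointDefect α (f + k • green l hl) n‖) ^ 2) :
    Summable fun n => (((2 : ℝ) ^ s * invSqrtTwo ^ 3) ^ n *
      ‖k * strength α l - approxValue f n‖) ^ 2 := by
  have hω := invSqrtTwo_pos
  have hg := greenNorm_pos
  have hp := Real.pi_pos
  have hsl := Real.sqrt_pos.2 hl
  have hf' := (mem_sobolev_iff_summable hs0 hs2).1 hf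
  have h1 : Summable fun n => ((2 ^ s : ℝ) ^ n *
      (‖k - charge α (f + k • green l hl) n‖ * ‖dyadicGreen n‖)) ^ 2 := by
    refine summable_sq_of_le_add (x := fun n => (2 ^ s : ℝ) ^ n * ‖freeDefect f n‖
        + (2 ^ s : ℝ) ^ n * ‖pointDefect α (f + k • green l hl) n‖)
      1 (fun n => by positivity) (fun n => ?_)
      (summable_sq_of_le_add 1 (fun n => by positivity) (fun n => by rw [one_mul]; exact le_rfl)
        hf' h)
      (summable_green_correction hs2 (‖k * l‖ * ‖green l hl‖))
    rw [one_mul, ← mul_add, ← mul_add]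
    gcongr
    have e1 : (k - charge α (f + k • green l hl) n) • dyadicGreen n
        = pointDefect α (f + k • green l hl) n - freeDefect f n
          + (k * l) • dyadicRes n (green l hl) := by
      rw [pointDefect_add_smul_green]
      module
    rw [← norm_smul, e1]
    refine (norm_add_le _ _).trans ?_
    gcongr
    · refine (norm_sub_le _ _).trans ?_
      rw [add_comm]
    · rw [norm_smul, mul_assoc]
      gcongr
      exact norm_dyadicRes_green_le hl n
  refine summable_sq_of_le_add ((α + 1) / greenNorm + 1) (fun n => by positivity) (fun n => ?_) h1
    (summable_sq_geometric (‖k‖ * (l / (4 * Real.pi))) (ρ := 2 ^ s * invSqrtTwo ^ 5)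
      (by positivity) (rpow_mul_invSqrtTwo_pow_five_lt hs2))
  have hspos := strength_pos hα (four_pow_pos n)
  have hs := strength_ne hα (four_pow_pos n)
  have h5 : ((2 : ℝ) ^ s * invSqrtTwo ^ 5) ^ n
      = ((2 : ℝ) ^ s * invSqrtTwo ^ 3) ^ n * (2 ^ n)⁻¹ := by
    rw [show invSqrtTwo ^ 5 = invSqrtTwo ^ 3 * invSqrtTwo ^ 2 by ring, invSqrtTwo_sq,
      ← mul_assoc, mul_pow, one_div, inv_pow]
  have h6 : l / (4 * Real.pi * (√l + 2 ^ n)) ≤ l / (4 * Real.pi) * (2 ^ n)⁻¹ := by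
    rw [← div_eq_mul_inv, div_div]
    gcongr
    linarith
  set d := ‖k - charge α (f + k • green l hl) n‖ with hd
  have e2 : k * strength α l - approxValue f n
      = (k - charge α (f + k • green l hl) n) * (strength α (4 ^ n) : ℂ)
        + k * ((l / (4 * Real.pi * (√l + 2 ^ n)) : ℝ) : ℂ) := by
    rw [sub_charge_add_smul_green hα hl, div_mul_cancel₀ _ hs]
    ring
  have h7 : ‖k * strength α l - approxValue f n‖
      ≤ d * ((α + 1) * 2 ^ n) + ‖k‖ * (l / (4 * Real.pi) * (2 ^ n)⁻¹) := by
    rw [e2]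
    refine (norm_add_le _ _).trans ?_
    rw [norm_mul, norm_mul, Complex.norm_real, Complex.norm_real,
      Real.norm_of_nonneg hspos.le, Real.norm_of_nonneg (by positivity)]
    gcongr
    exact strength_four_pow_le hα n
  have h2 : (2 : ℝ) ^ n ≠ 0 := by positivity
  set ρ := ((2 : ℝ) ^ s * invSqrtTwo ^ 3) ^ n with hρ
  have hρ0 : 0 ≤ ρ := by positivity
  have h8 : ρ * (d * ((α + 1) * 2 ^ n))
      = (α + 1) / greenNorm * ((2 ^ s) ^ n * (d * ‖dyadicGreen n‖)) := by
    rw [hρ, rpow_mul_invSqrtTwo_pow_three_pow, norm_dyadicGreen]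
    field_simp
  rw [h5]
  calc ρ * ‖k * strength α l - approxValue f n‖
      ≤ ρ * (d * ((α + 1) * 2 ^ n) + ‖k‖ * (l / (4 * Real.pi) * (2 ^ n)⁻¹)) := by gcongr
    _ = (α + 1) / greenNorm * ((2 ^ s) ^ n * (d * ‖dyadicGreen n‖))
        + 1 * (‖k‖ * (l / (4 * Real.pi)) * (ρ * (2 ^ n)⁻¹)) := by rw [mul_add, h8]; ring
    _ ≤ ((α + 1) / greenNorm + 1) * ((2 ^ s) ^ n * (d * ‖dyadicGreen n‖))
        + ((α + 1) / greenNorm + 1) * (‖k‖ * (l / (4 * Real.pi)) * (ρ * (2 ^ n)⁻¹)) := by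
        have : 0 ≤ (α + 1) / greenNorm := by positivity
        gcongr
        · linarith
        · linarith
    _ = _ := by ring

/-- The increments of the charges of a vector in the domain of `(-Δ_α)^{s/2}` are square summable
with weights `2^{n(s - 1/2)}`. -/
theorem summable_charge_sub (hs0 : 0 < s) {g : L2}
    (h : Summable fun n => ((2 ^ s : ℝ) ^ n * ‖pointDefect α g n‖) ^ 2) :
    Summable fun n => (((2 : ℝ) ^ s * invSqrtTwo) ^ n *
      ‖charge α g (n + 1) - charge α g n‖) ^ 2 := by
  have hω := invSqrtTwo_pos
  have hg := greenNorm_pos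
  refine summable_sq_of_le_add (1 / (greenNorm * invSqrtTwo)) (fun n => by positivity)
    (fun n => ?_) h (summable_shift h)
  have h1 := norm_charge_sub_mul_le α g n
  rw [norm_dyadicGreen] at h1
  have hσ := one_le_two_rpow hs0
  calc ((2 : ℝ) ^ s * invSqrtTwo) ^ n * ‖charge α g (n + 1) - charge α g n‖
      = 1 / (greenNorm * invSqrtTwo) * ((2 ^ s) ^ n * (‖charge α g (n + 1) - charge α g n‖
          * (greenNorm * invSqrtTwo ^ (n + 1)))) := by
        rw [mul_pow, pow_succ]; field_simp
    _ ≤ 1 / (greenNorm * invSqrtTwo) * ((2 ^ s) ^ n *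
          (‖pointDefect α g n‖ + ‖pointDefect α g (n + 1)‖)) := by gcongr
    _ ≤ _ := by
        rw [mul_add]
        gcongr
        exact Nat.le_succ n

/-- If the charges of `g` are close to `q`, then `g - q G_l` is as regular as `g` is with respect
to `-Δ_α`. -/
theorem sub_smul_green_mem_sobolev (hl : 0 < l) (hs0 : 0 < s) (hs2 : s < 2) {g : L2} {q : ℂ}
    (h : Summable fun n => ((2 ^ s : ℝ) ^ n * ‖pointDefect α g n‖) ^ 2)
    (hq : Summable fun n => (((2 : ℝ) ^ s * invSqrtTwo) ^ n * ‖charge α g n - q‖) ^ 2) :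
    g - q • green l hl ∈ sobolev s := by
  have hω := invSqrtTwo_pos
  have hg := greenNorm_pos
  rw [mem_sobolev_iff_summable hs0 hs2]
  have h1 : Summable fun n => ((2 ^ s : ℝ) ^ n * (‖charge α g n - q‖ * ‖dyadicGreen n‖)) ^ 2 := by
    refine summable_sq_of_le greenNorm (fun n => by positivity) (fun n => ?_) hq
    rw [norm_dyadicGreen, mul_pow]
    exact le_of_eq (by ring)
  refine summable_sq_of_le_add (x := fun n => (2 ^ s : ℝ) ^ n * ‖pointDefect α g n‖
      + (2 ^ s : ℝ) ^ n * (‖charge α g n - q‖ * ‖dyadicGreen n‖))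
    1 (fun n => by positivity) (fun n => ?_)
    (summable_sq_of_le_add 1 (fun n => by positivity) (fun n => by rw [one_mul]) h h1)
    (summable_green_correction hs2 (‖q * l‖ * ‖green l hl‖))
  rw [one_mul, ← mul_add, ← mul_add]
  gcongr
  change ‖freeDefect (g - q • green l hl) n‖ ≤ _
  have e1 : freeDefect (g - q • green l hl) n = pointDefect α g n
      + (charge α g n - q) • dyadicGreen n + (q * l) • dyadicRes n (green l hl) := by
    rw [sub_eq_add_neg, ← neg_smul, freeDefect_add_smul, freeDefect_green, pointDefect]
    module
  rw [e1]
  refine (norm_add_le _ _).trans ?_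
  gcongr
  · refine (norm_add_le _ _).trans ?_
    rw [norm_smul]
  · rw [norm_smul, mul_assoc]
    gcongr
    exact norm_dyadicRes_green_le hl n

theorem not_summable_sq_of_one_le {r : ℝ} (hr : 1 ≤ r) {x : ℕ → ℝ} {c : ℝ} (hc : 0 < c)
    (hx : Filter.Tendsto x Filter.atTop (nhds c)) : ¬ Summable fun n => (r ^ n * x n) ^ 2 := by
  intro h
  have h1 : Filter.Tendsto (fun n => x n ^ 2) Filter.atTop (nhds 0) := by
    refine squeeze_zero (fun n => sq_nonneg _) (fun n => ?_) h.tendsto_atTop_zero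
    rw [mul_pow]
    exact le_mul_of_one_le_left (sq_nonneg _) (one_le_pow₀ (one_le_pow₀ hr))
  have h2 := tendsto_nhds_unique h1 (hx.pow 2)
  have : 0 < c ^ 2 := by positivity
  linarith

/-- The vectors `-Δ (-Δ + 4^n)⁻¹ G_l` are close to `G_{4^n}`, whose norms do not decay fast
enough. -/
theorem green_notMem_sobolev (hl : 0 < l) (hs : 1 / 2 ≤ s) (hs2 : s < 2) :
    green l hl ∉ sobolev s := by
  intro hmem
  have hω := invSqrtTwo_pos
  have hg := greenNorm_pos
  have h1 := (mem_sobolev_iff_summable (by linarith) hs2).1 hmem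
  have hr : 1 ≤ (2 : ℝ) ^ s * invSqrtTwo := by
    rw [rpow_mul_invSqrtTwo]
    exact Real.one_le_rpow (by norm_num) (by linarith)
  refine not_summable_sq_of_one_le hr hg (x := fun _ => greenNorm) tendsto_const_nhds ?_
  refine summable_sq_of_le_add 1 (fun n => by positivity) (fun n => ?_) h1
    (summable_green_correction hs2 (‖(l : ℂ)‖ * ‖green l hl‖))
  rw [one_mul, ← mul_add, mul_pow, mul_assoc]
  gcongr
  rw [mul_comm, ← norm_dyadicGreen]
  change _ ≤ ‖freeDefect (green l hl) n‖ + _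
  have e1 : dyadicGreen n = freeDefect (green l hl) n + (l : ℂ) • dyadicRes n (green l hl) := by
    rw [freeDefect_green]; module
  rw [e1]
  refine (norm_add_le _ _).trans ?_
  gcongr
  rw [norm_smul, mul_assoc]
  gcongr
  exact norm_dyadicRes_green_le hl n

/-- For `f` with integrable Fourier transform, `4^n ⟪G_{4^n}, f⟫` tends to `f(0)`. -/
theorem tendsto_approxValue {f : L2} (hf : Integrable ((𝓕 f : L2) : R3 → ℂ)) {v : ℂ}
    (hv : HasValueAtZero f v) : Filter.Tendsto (approxValue f) Filter.atTop (nhds v) := by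
  rw [hv.unique (hasValueAtZero_of_integrable_fourier hf)]
  have h1 : ∀ n, approxValue f n
      = ∫ ξ, ((4 ^ n / (symb ξ + 4 ^ n) : ℝ) : ℂ) * (𝓕 f : L2) ξ := by
    intro n
    rw [approxValue, inner_green, ← integral_const_mul]
    refine integral_congr_ae (Filter.Eventually.of_forall fun ξ => ?_)
    simp only
    rw [← Complex.ofReal_inv, ← mul_assoc, ← Complex.ofReal_mul, ← div_eq_mul_inv]
  simp_rw [funext h1]
  refine tendsto_integral_filter_of_dominated_convergence (fun ξ => ‖(𝓕 f : L2) ξ‖)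
    (Filter.Eventually.of_forall fun n => ?_)
    (Filter.Eventually.of_forall fun n => Filter.Eventually.of_forall fun ξ => ?_) hf.norm
    (Filter.Eventually.of_forall fun ξ => ?_)
  · refine AEStronglyMeasurable.mul ?_ (Lp.aestronglyMeasurable _)
    exact Measurable.aestronglyMeasurable (by fun_prop)
  · have h2 := symb_nonneg ξ
    rw [norm_mul, Complex.norm_real, Real.norm_of_nonneg (by positivity)]
    refine mul_le_of_le_one_left (norm_nonneg _) ?_
    rw [div_le_one (by positivity)]
    linarith
  · have h3 : Filter.Tendsto (fun n : ℕ => 1 - symb ξ * (symb ξ + 4 ^ n)⁻¹) Filter.atTop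
        (nhds (1 - symb ξ * 0)) := by
      refine Filter.Tendsto.const_sub 1 (Filter.Tendsto.const_mul _ ?_)
      exact (Filter.tendsto_atTop_add_const_left _ _
        (tendsto_pow_atTop_atTop_of_one_lt (by norm_num))).inv_tendsto_atTop
    rw [mul_zero, sub_zero] at h3
    have h4 : Filter.Tendsto (fun n : ℕ => 4 ^ n / (symb ξ + 4 ^ n)) Filter.atTop (nhds 1) := by
      refine h3.congr fun n => ?_
      have h2 := symb_add_pos (four_pow_pos n) ξ
      field_simp
      ring
    have h5 := ((Complex.continuous_ofReal.tendsto _).comp h4).mul_const ((𝓕 f : L2) ξ)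
    simpa using h5

end Sobolev

/-! ### The domains of the fractional powers -/

section Domains

variable {α l₀ l s : ℝ}

/-- Below the threshold `3/2`, the charge of the singular part is free. -/
theorem add_smul_green_mem_powerDomain (hα : 0 ≤ α) (hl₀ : 0 < l₀) (hl : 0 < l) (hs0 : 0 < s)
    (hs : s < 3 / 2) {f : L2} (hf : f ∈ sobolev s) (k : ℂ) :
    f + k • green l hl ∈ powerDomain (hamiltonian α l₀ hl₀) (s / 2) := by
  have hω := invSqrtTwo_pos
  have hr : (2 : ℝ) ^ s * invSqrtTwo ^ 3 < 1 := by
    rw [rpow_mul_invSqrtTwo_pow_three]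
    exact Real.rpow_lt_one_of_one_lt_of_neg (by norm_num) (by linarith)
  rw [mem_powerDomain_hamiltonian_iff hα hl₀ hs0 (by linarith)]
  refine summable_pointDefect_of_summable hα hl hs0 (by linarith) hf ?_
  refine summable_sq_of_le_add 1 (fun n => by positivity) (fun n => ?_)
    (summable_sq_of_increments (by positivity) hr
      (summable_approxValue_sub hs0 (by linarith) hf))
    (summable_sq_geometric ‖k * strength α l‖ (by positivity) hr)
  rw [one_mul, mul_comm ‖k * _‖, ← mul_add, add_comm]
  gcongr
  exact norm_sub_le _ _

/-- Above the threshold `3/2`, the charge of the singular part is determined by the value of the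
regular part at the origin. -/
theorem add_smul_green_mem_powerDomain_iff (hα : 0 ≤ α) (hl₀ : 0 < l₀) (hl : 0 < l)
    (hs : 3 / 2 < s) (hs2 : s < 2) {f : L2} (hf : f ∈ sobolev s) {v : ℂ}
    (hv : HasValueAtZero f v) (k : ℂ) :
    f + k • green l hl ∈ powerDomain (hamiltonian α l₀ hl₀) (s / 2) ↔
      k = v / (strength α l : ℂ) := by
  have hs0 : 0 < s := by linarith
  have hr : 1 < (2 : ℝ) ^ s * invSqrtTwo ^ 3 := by
    rw [rpow_mul_invSqrtTwo_pow_three]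
    exact Real.one_lt_rpow (by norm_num) (by linarith)
  have hlim := tendsto_approxValue (integrable_fourier_of_mem_sobolev hs hf) hv
  rw [mem_powerDomain_hamiltonian_iff hα hl₀ hs0 hs2, eq_div_iff (strength_ne hα hl)]
  constructor
  · intro h
    by_contra hne
    refine not_summable_sq_of_one_le hr.le (norm_pos_iff.2 (sub_ne_zero.2 hne))
      (hlim.const_sub _).norm (summable_of_summable_pointDefect hα hl hs0 hs2 hf h)
  · intro hk
    refine summable_pointDefect_of_summable hα hl hs0 hs2 hf ?_
    obtain ⟨L, hL, hsum⟩ := exists_tendsto_summable_sq_of_increments hr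
      (summable_approxValue_sub hs0 hs2 hf)
    rw [tendsto_nhds_unique hL hlim] at hsum
    simpa only [hk, norm_sub_rev] using hsum

/-- Below the threshold `1/2`, vectors in the domain have no singular part that could be separated:
the charges themselves are summable against the norms of the Green functions. -/
theorem mem_sobolev_of_mem_powerDomain (hα : 0 ≤ α) (hl₀ : 0 < l₀) (hs0 : 0 < s)
    (hs : s < 1 / 2) {g : L2} (hg : g ∈ powerDomain (hamiltonian α l₀ hl₀) (s / 2)) :
    g ∈ sobolev s := by
  have hω := invSqrtTwo_pos
  rw [mem_powerDomain_hamiltonian_iff hα hl₀ hs0 (by linarith)] at hg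
  have hr : (2 : ℝ) ^ s * invSqrtTwo < 1 := by
    rw [rpow_mul_invSqrtTwo]
    exact Real.rpow_lt_one_of_one_lt_of_neg (by norm_num) (by linarith)
  have h1 := summable_sq_of_increments (by positivity) hr (summable_charge_sub hs0 hg)
  have h2 := sub_smul_green_mem_sobolev (q := 0) one_pos hs0 (by linarith) hg
    (by simpa only [sub_zero] using h1)
  rwa [zero_smul, sub_zero] at h2

/-- Above the threshold `1/2`, the charges converge, and their limit is the coefficient of the
singular part. -/
theorem exists_sub_smul_green_mem_sobolev (hα : 0 ≤ α) (hl₀ : 0 < l₀) (hl : 0 < l)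
    (hs : 1 / 2 < s) (hs2 : s < 2) {g : L2}
    (hg : g ∈ powerDomain (hamiltonian α l₀ hl₀) (s / 2)) :
    ∃ q : ℂ, g - q • green l hl ∈ sobolev s := by
  have hs0 : 0 < s := by linarith
  rw [mem_powerDomain_hamiltonian_iff hα hl₀ hs0 hs2] at hg
  have hr : 1 < (2 : ℝ) ^ s * invSqrtTwo := by
    rw [rpow_mul_invSqrtTwo]
    exact Real.one_lt_rpow (by norm_num) (by linarith)
  obtain ⟨q, -, hq⟩ := exists_tendsto_summable_sq_of_increments hr (summable_charge_sub hs0 hg)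
  exact ⟨q, sub_smul_green_mem_sobolev hl hs0 hs2 hg hq⟩

end Domains

end PointInteraction

end

theorem theorem1 (α : ℝ) (hα : 0 ≤ α) (l₀ : ℝ) (hl₀ : 0 < l₀) (l : ℝ) (hl : 0 < l) (s : ℝ) :
    (s ∈ Set.Ioo (0 : ℝ) (1 / 2) →
      PointInteraction.powerDomain (PointInteraction.hamiltonian α l₀ hl₀) (s / 2)
        = (PointInteraction.sobolev s : Set PointInteraction.L2)) ∧
    (s ∈ Set.Ioo (1 / 2 : ℝ) (3 / 2) →
      PointInteraction.powerDomain (PointInteraction.hamiltonian α l₀ hl₀) (s / 2)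
        = ((PointInteraction.sobolev s ⊔ Submodule.span ℂ {PointInteraction.green l hl} :
            Submodule ℂ PointInteraction.L2) : Set PointInteraction.L2) ∧
      Disjoint (PointInteraction.sobolev s)
        (Submodule.span ℂ {PointInteraction.green l hl})) ∧
    (s ∈ Set.Ioo (3 / 2 : ℝ) 2 →
      (∀ F ∈ PointInteraction.sobolev s, ∃! v : ℂ, PointInteraction.HasValueAtZero F v) ∧
      PointInteraction.powerDomain (PointInteraction.hamiltonian α l₀ hl₀) (s / 2)
        = {g : PointInteraction.L2 | ∃ F ∈ PointInteraction.sobolev s, ∃ v : ℂ,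
            PointInteraction.HasValueAtZero F v ∧
            g = F + (v / ((α + Real.sqrt l / (4 * Real.pi) : ℝ) : ℂ)) •
              PointInteraction.green l hl}) := by
  refine ⟨fun ⟨hs0, hs⟩ => ?_, fun ⟨hs0, hs⟩ => ⟨?_, ?_⟩, fun ⟨hs0, hs⟩ => ⟨fun F hF => ?_, ?_⟩⟩
  · ext g
    refine ⟨PointInteraction.mem_sobolev_of_mem_powerDomain hα hl₀ hs0 hs, fun hg => ?_⟩
    have h := PointInteraction.add_smul_green_mem_powerDomain hα hl₀ hl hs0 (by linarith) hg 0
    rwa [zero_smul, add_zero] at h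
  · ext g
    rw [SetLike.mem_coe, Submodule.mem_sup]
    constructor
    · intro hg
      obtain ⟨q, hq⟩ := PointInteraction.exists_sub_smul_green_mem_sobolev hα hl₀ hl hs0
        (by linarith) hg
      exact ⟨_, hq, _, Submodule.smul_mem _ q (Submodule.mem_span_singleton_self _),
        sub_add_cancel _ _⟩
    · rintro ⟨f, hf, y, hy, rfl⟩
      obtain ⟨k, rfl⟩ := Submodule.mem_span_singleton.1 hy
      exact PointInteraction.add_smul_green_mem_powerDomain hα hl₀ hl (by linarith) hs hf k
  · rw [Submodule.disjoint_def]
    intro x hx hx'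
    obtain ⟨k, rfl⟩ := Submodule.mem_span_singleton.1 hx'
    by_cases hk : k = 0
    · rw [hk, zero_smul]
    · have h := Submodule.smul_mem _ k⁻¹ hx
      rw [smul_smul, inv_mul_cancel₀ hk, one_smul] at h
      exact absurd h (PointInteraction.green_notMem_sobolev hl hs0.le (by linarith))
  · exact ⟨_, PointInteraction.hasValueAtZero_of_integrable_fourier
      (PointInteraction.integrable_fourier_of_mem_sobolev hs0 hF),
      fun w hw => hw.unique (PointInteraction.hasValueAtZero_of_integrable_fourier
        (PointInteraction.integrable_fourier_of_mem_sobolev hs0 hF))⟩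
  · ext g
    constructor
    · intro hg
      obtain ⟨q, hq⟩ := PointInteraction.exists_sub_smul_green_mem_sobolev hα hl₀ hl
        (by linarith) hs hg
      have hv := PointInteraction.hasValueAtZero_of_integrable_fourier
        (PointInteraction.integrable_fourier_of_mem_sobolev hs0 hq)
      rw [← sub_add_cancel g (q • PointInteraction.green l hl),
        PointInteraction.add_smul_green_mem_powerDomain_iff hα hl₀ hl hs0 hs hq hv] at hg
      refine ⟨_, hq, _, hv, ?_⟩
      rw [PointInteraction.strength] at hg
      rw [← hg, sub_add_cancel]
    · rintro ⟨F, hF, v, hv, rfl⟩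
      exact (PointInteraction.add_smul_green_mem_powerDomain_iff hα hl₀ hl hs0 hs hF hv _).2 rfl
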